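/- **Setting.** An $\ell$-algebra is a commutative unital $\mathbb R$-algebra $A$ with a lattice order such that $a\le b$ implies $a+c\le b+c$, such that $0\le a,b$ implies $0\le ab$, and such that $0\le r\in\mathbb R$, $0\le a$ imply $0\le ra$. It is *bounded* if for each $a\in A$ there is $n\in\mathbb N$ with $a\le n\cdot 1$, and *archimedean* if, whenever $n\cdot a\le b$ for all $n\in\mathbb N$, then $a\le 0$. Let $\boldsymbol{\mathit{ba}\ell}$ be the category of bounded archimedean $\ell$-algebras and unital $\ell$-algebra homomorphisms. Real numbers $r$ are identified with $r\cdot 1\in A$; put $a^+=a\vee 0$, $|a|=a\vee(-a)$ and $\|a\|=\inf\{r\in\mathbb R\mid |a|\le r\}$ (with $\|a\|=0$ in the zero algebra). An $\ell$-ideal is a ring ideal $I$ such that $|a|\le|b|$ and $b\in I$ imply $a\in I$; it is archimedean if $A/I$ is archimedean. Let $\mathsf{KHaus}$ be the category of compact Hausdorff spaces and continuous maps. *Gelfand duality functors.* For $A\in\boldsymbol{\mathit{ba}\ell}$ let $Y_A=\mathsf Y(A)$ be the set of maximal $\ell$-ideals of $A$, the closed sets being exactly the sets $Z_\ell(I)=\{M\mid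 I\subseteq M\}$ for $\ell$-ideals $I$ of $A$; $\mathsf Y(\gamma)=\gamma^{-1}$. For $X\in\mathsf{KHaus}$ let $\mathsf C(X)=C(X)$ be the $\ell$-algebra of continuous functions $X\to\mathbb R$; $\mathsf C(\varphi)(f)=f\circ\varphi$. These are contravariant functors between $\boldsymbol{\mathit{ba}\ell}$ and $\mathsf{KHaus}$. Let $\zeta_A:A\to C(Y_A)$ send $a$ to the function whose value at $M$ is the unique $r\in\mathbb R$ with $a-r\in M$, and let $\varepsilon_X:X\to Y_{C(X)}$ be $\varepsilon_X(x)=\{f\in C(X)\mid f(x)=0\}$. *The functor $\mathsf H$.* For $A\in\boldsymbol{\mathit{ba}\ell}$ put $w_A(a)=\max\{\|a\|,1\}$. Let $f_A:A\to F(A)$ be the free object of $\boldsymbol{\mathit{ba}\ell}$ on the weighted set $(A,w_A)$: $\|f_A(a)\|\le w_A(a)$ for all $a$, and every map $k:A\to B$ with $B\in\boldsymbol{\mathit{ba}\ell}$ and $\|k(a)\|\le w_A(a)$ for all $a$ factors as $\tau\circ f_A$ for a unique morphism $\tau:F(A)\to B$. Let $I_A$ be the archimedean $\ell$-ideal of $F(A)$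 generated by the elements, for $a,b\in A$ and $r\in\mathbb R$, - $f_A(a\wedge b)-f_A(a)\wedge f_A(b)$; - $f_A(r)-r-(1-r)f_A(0)$; - $f_A(a^+)-f_A(a)^+$; - $f_A(a+r)-f_A(a)-f_A(r)+f_A(0)$; - $f_A(ra)-f_A(r)f_A(a)$ if $0\le r$. Put $\mathsf H(A)=F(A)/I_A$ and let $\Box_a\in\mathsf H(A)$ be the class of $f_A(a)$. For $\gamma:A\to B$ let $\mathsf H(\gamma):\mathsf H(A)\to\mathsf H(B)$ be the unique morphism with $\Box_a\mapsto\Box_{\gamma(a)}$. This is an endofunctor of $\boldsymbol{\mathit{ba}\ell}$. *The functor $\mathsf V$.* For $X\in\mathsf{KHaus}$ let $\mathsf V(X)$ be the set of all closed subsets of $X$, including $\varnothing$, with the topology generated by the sets $\{F\mid F\subseteq U\}$ and $\{F\mid F\cap U\neq\varnothing\}$ for $U\subseteq X$ open; $\mathsf V(\varphi)(F)=\varphi(F)$. This is an endofunctor of $\mathsf{KHaus}$. *The transformation $\eta$.* For $A\in\boldsymbol{\mathit{ba}\ell}$ let $\eta_A:\mathsf H(A)\to C(\mathsf V(Y_A))$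 be the unique morphism such that $\eta_A(\Box_a)(F)=\inf\zeta_A(a)(F)$ for $F\neq\varnothing$ and $\eta_A(\Box_a)(\varnothing)=1$. *Algebras and coalgebras.* $\mathsf{Alg}(\mathsf H)$ has as objects the pairs $(A,\alpha)$ with $\alpha:\mathsf H(A)\to A$ in $\boldsymbol{\mathit{ba}\ell}$, and as morphisms $(A,\alpha)\to(A',\alpha')$ the $\gamma:A\to A'$ with $\gamma\circ\alpha=\alpha'\circ\mathsf H(\gamma)$. $\mathsf{Coalg}(\mathsf V)$ has as objects the pairs $(X,\sigma)$ with $\sigma:X\to\mathsf V(X)$ in $\mathsf{KHaus}$, and as morphisms $(X,\sigma)\to(X',\sigma')$ the $\varphi:X\to X'$ with $\sigma'\circ\varphi=\mathsf V(\varphi)\circ\sigma$. **Theorem.** For every $X\in\mathsf{KHaus}$ the map $\varepsilon_X$ is a homeomorphism, and for every $A\in\boldsymbol{\mathit{ba}\ell}$ the map $\mathsf Y(\eta_A):Y_{C(\mathsf V(Y_A))}\to Y_{\mathsf H(A)}$ is a homeomorphism. Consequently $$\mathsf F(A,\alpha)=\bigl(Y_A,\ \varepsilon_{\mathsf V(Y_A)}^{-1}\circ\mathsf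 Y(\eta_A)^{-1}\circ\mathsf Y(\alpha)\bigr),\qquad \mathsf F(\gamma)=\mathsf Y(\gamma),$$ $$\mathsf G(X,\sigma)=\bigl(C(X),\ \mathsf C(\sigma)\circ\mathsf C(\mathsf V(\varepsilon_X))\circ\eta_{C(X)}\bigr),\qquad \mathsf G(\varphi)=\mathsf C(\varphi)$$ are well-defined contravariant functors $\mathsf F:\mathsf{Alg}(\mathsf H)\to\mathsf{Coalg}(\mathsf V)$ and $\mathsf G:\mathsf{Coalg}(\mathsf V)\to\mathsf{Alg}(\mathsf H)$. They form a dual adjunction: there is a bijection $$\mathsf{Alg}(\mathsf H)\bigl((A,\alpha),\mathsf G(X,\sigma)\bigr)\;\cong\;\mathsf{Coalg}(\mathsf V)\bigl((X,\sigma),\mathsf F(A,\alpha)\bigr),$$ natural in $(A,\alpha)\in\mathsf{Alg}(\mathsf H)$ and $(X,\sigma)\in\mathsf{Coalg}(\mathsf V)$, whose units are the morphisms $\zeta_A:(A,\alpha)\to\mathsf G\mathsf F(A,\alpha)$ of $\mathsf{Alg}(\mathsf H)$ and $\varepsilon_X:(X,\sigma)\to\mathsf F\mathsf G(X,\sigma)$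 of $\mathsf{Coalg}(\mathsf V)$. -/

import Mathlib

open CategoryTheory Opposite TopologicalSpace
open scoped NNReal

universe u v

noncomputable section

namespace Bal

/-- `A` is a bounded archimedean `ℓ`-algebra. -/
class IsBal (A : Type*) [CommRing A] [Lattice A] [Algebra ℝ A] : Prop where
  add_right : ∀ a b : A, a ≤ b → ∀ c, a + c ≤ b + c
  mul_nonneg : ∀ a b : A, 0 ≤ a → 0 ≤ b → 0 ≤ a * b
  smul_nonneg : ∀ (r : ℝ) (a : A), 0 ≤ r → 0 ≤ a → 0 ≤ r • a
  bounded : ∀ a : A, ∃ n : ℕ, a ≤ n • (1 : A)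
  archimedean : ∀ a b : A, (∀ n : ℕ, n • a ≤ b) → a ≤ 0

section Basic

variable {A : Type*} [CommRing A] [Lattice A] [Algebra ℝ A] [IsBal A]

instance : IsOrderedAddMonoid A where
  add_le_add_left a b h c := IsBal.add_right a b h c

theorem zero_le_one' : (0 : A) ≤ 1 := by
  obtain ⟨n, hn⟩ := IsBal.bounded ((1 : A) ⊔ 0)
  rcases Nat.eq_zero_or_pos n with rfl | hpos
  · have h1 : (1 : A) ≤ 0 := le_sup_left.trans (hn.trans (by simp))
    have h2 : (0 : A) ≤ -1 := by simpa using h1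
    simpa using IsBal.mul_nonneg _ _ h2 h2
  · have h0 : (0 : A) ≤ n • (1 : A) := le_sup_right.trans hn
    have h1 := IsBal.smul_nonneg ((n : ℝ)⁻¹) _ (by positivity) h0
    have hne : (n : ℝ) ≠ 0 := by positivity
    rwa [← Nat.cast_smul_eq_nsmul ℝ, smul_smul, inv_mul_cancel₀ hne, one_smul] at h1

instance : ZeroLEOneClass A := ⟨zero_le_one'⟩

instance : IsOrderedRing A := .of_mul_nonneg IsBal.mul_nonneg

theorem algebraMap_mono : Monotone (algebraMap ℝ A) := by
  intro r s h
  have := IsBal.smul_nonneg (s - r) (1 : A) (sub_nonneg.2 h) zero_le_one'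
  rw [← Algebra.algebraMap_eq_smul_one, map_sub] at this
  exact sub_nonneg.1 this

variable (A) in
theorem algebraMap_sup (r s : ℝ) :
    algebraMap ℝ A (r ⊔ s) = algebraMap ℝ A r ⊔ algebraMap ℝ A s :=
  algebraMap_mono.map_sup r s

variable (A) in
theorem algebraMap_inf (r s : ℝ) :
    algebraMap ℝ A (r ⊓ s) = algebraMap ℝ A r ⊓ algebraMap ℝ A s :=
  algebraMap_mono.map_inf r s

theorem nonneg_of_add_self {x : A} (hx : 0 ≤ x + x) : 0 ≤ x := by
  have := IsBal.smul_nonneg (1 / 2 : ℝ) _ (by norm_num) hx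
  rwa [← two_smul ℝ x, smul_smul, show (1 / 2 : ℝ) * 2 = 1 by norm_num, one_smul] at this

theorem abs_mul_le {a b P Q : A} (h1 : |a| ≤ P) (h2 : |b| ≤ Q) : |a * b| ≤ P * Q := by
  have a1 : 0 ≤ P - a := sub_nonneg.2 ((le_abs_self a).trans h1)
  have a2 : 0 ≤ P + a := by
    have := (neg_le_abs a).trans h1; rw [← sub_nonneg] at this; simpa using this
  have b1 : 0 ≤ Q - b := sub_nonneg.2 ((le_abs_self b).trans h2)
  have b2 : 0 ≤ Q + b := by
    have := (neg_le_abs b).trans h2; rw [← sub_nonneg] at this; simpa using this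
  refine abs_le'.2 ⟨sub_nonneg.1 (nonneg_of_add_self ?_), sub_nonneg.1 (nonneg_of_add_self ?_)⟩
  · have := add_nonneg (mul_nonneg a1 b2) (mul_nonneg a2 b1)
    calc (0 : A) ≤ _ := this
      _ = _ := by ring
  · have := add_nonneg (mul_nonneg a1 b1) (mul_nonneg a2 b2)
    calc (0 : A) ≤ _ := this
      _ = _ := by ring

/-- The norm `‖a‖ = inf {r | |a| ≤ r · 1}`. -/
def norm (a : A) : ℝ := sInf {r : ℝ | |a| ≤ algebraMap ℝ A r}

theorem exists_abs_le (a : A) : ∃ r : ℝ, |a| ≤ algebraMap ℝ A r := by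
  obtain ⟨n, hn⟩ := IsBal.bounded |a|
  exact ⟨n, by simpa using hn⟩

theorem abs_le_norm (a : A) : |a| ≤ algebraMap ℝ A (norm a) := by
  rw [← sub_nonpos]
  refine IsBal.archimedean _ 1 fun n => ?_
  have hpos : (0 : ℝ) < 1 / (n + 1) := by positivity
  obtain ⟨r, hr, hlt⟩ := exists_lt_of_csInf_lt (s := {r : ℝ | |a| ≤ algebraMap ℝ A r})
    (exists_abs_le a) (lt_add_of_pos_right (norm a) hpos)
  have h1 : |a| - algebraMap ℝ A (norm a) ≤ algebraMap ℝ A (1 / (n + 1)) := by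
    rw [sub_le_iff_le_add, ← map_add]
    exact le_trans hr (algebraMap_mono (by linarith))
  calc n • (|a| - algebraMap ℝ A (norm a)) ≤ n • algebraMap ℝ A (1 / (n + 1)) :=
        nsmul_le_nsmul_right h1 n
    _ = algebraMap ℝ A (n * (1 / (n + 1))) := by simp
    _ ≤ algebraMap ℝ A 1 := algebraMap_mono (by
        rw [mul_one_div, div_le_one (by positivity)]; linarith)
    _ = 1 := map_one _

end Basic

theorem norm_le {A : Type*} [CommRing A] [Lattice A] [Algebra ℝ A] {a : A} {r : ℝ}
    (hr : 0 ≤ r) (h : |a| ≤ algebraMap ℝ A r) : norm a ≤ r := by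
  by_cases hb : BddBelow {r : ℝ | |a| ≤ algebraMap ℝ A r}
  · exact csInf_le hb h
  · rw [norm, Real.sInf_of_not_bddBelow hb]; exact hr

/-- Unital `ℓ`-algebra morphisms. -/
@[ext]
structure Hom (A B : Type*) [CommRing A] [Lattice A] [Algebra ℝ A]
    [CommRing B] [Lattice B] [Algebra ℝ B] extends A →ₐ[ℝ] B where
  map_sup' : ∀ a b : A, toFun (a ⊔ b) = toFun a ⊔ toFun b
  map_inf' : ∀ a b : A, toFun (a ⊓ b) = toFun a ⊓ toFun b

namespace Hom

variable {A B D : Type*} [CommRing A] [Lattice A] [Algebra ℝ A]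
  [CommRing B] [Lattice B] [Algebra ℝ B] [CommRing D] [Lattice D] [Algebra ℝ D]

instance : FunLike (Hom A B) A B where
  coe f := f.toFun
  coe_injective f g h := by
    cases f; cases g; congr; exact DFunLike.coe_injective h

instance : AlgHomClass (Hom A B) ℝ A B where
  map_mul f := map_mul f.toAlgHom
  map_one f := map_one f.toAlgHom
  map_add f := map_add f.toAlgHom
  map_zero f := map_zero f.toAlgHom
  commutes f := AlgHomClass.commutes f.toAlgHom

instance : LatticeHomClass (Hom A B) A B where
  map_sup f := f.map_sup'
  map_inf f := f.map_inf'

theorem ext' {f g : Hom A B} (h : ∀ a, f a = g a) : f = g := DFunLike.ext _ _ h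

/-- The identity morphism. -/
def id (A : Type*) [CommRing A] [Lattice A] [Algebra ℝ A] : Hom A A where
  toAlgHom := AlgHom.id ℝ A
  map_sup' _ _ := rfl
  map_inf' _ _ := rfl

/-- Composition of morphisms. -/
def comp (g : Hom B D) (f : Hom A B) : Hom A D where
  toAlgHom := g.toAlgHom.comp f.toAlgHom
  map_sup' a b := by
    change g (f (a ⊔ b)) = g (f a) ⊔ g (f b)
    rw [map_sup, map_sup]
  map_inf' a b := by
    change g (f (a ⊓ b)) = g (f a) ⊓ g (f b)
    rw [map_inf, map_inf]

@[simp] theorem id_apply (a : A) : Hom.id A a = a := rfl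
@[simp] theorem comp_apply (g : Hom B D) (f : Hom A B) (a : A) : g.comp f a = g (f a) := rfl

theorem map_abs (f : Hom A B) (a : A) : f |a| = |f a| := by
  simp [abs, map_sup]

theorem map_algebraMap (f : Hom A B) (r : ℝ) : f (algebraMap ℝ A r) = algebraMap ℝ B r :=
  AlgHomClass.commutes f r

theorem map_mono (f : Hom A B) : Monotone f := OrderHomClass.mono f

theorem abs_map_le (f : Hom A B) {a : A} {r : ℝ} (h : |a| ≤ algebraMap ℝ A r) :
    |f a| ≤ algebraMap ℝ B r := by
  rw [← map_abs, ← f.map_algebraMap]; exact f.map_mono h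

end Hom

/-- Objects of `baℓ`. -/
structure BAL : Type (u + 1) where
  carrier : Type u
  [commRing : CommRing carrier]
  [lattice : Lattice carrier]
  [algebra : Algebra ℝ carrier]
  [isBal : IsBal carrier]

attribute [instance] BAL.commRing BAL.lattice BAL.algebra BAL.isBal

instance : CoeSort BAL.{u} (Type u) := ⟨BAL.carrier⟩

/-- The category `baℓ` of bounded archimedean `ℓ`-algebras and unital `ℓ`-algebra morphisms. -/
instance : Category BAL.{u} where
  Hom A B := Hom A B
  id A := Hom.id A
  comp f g := Hom.comp g f

instance : ConcreteCategory BAL.{u} (fun A B => Hom A B) where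
  hom f := f
  ofHom f := f

/-- The underlying `ℓ`-algebra morphism of a morphism of `baℓ`. -/
abbrev BAL.hom {A B : BAL.{u}} (f : A ⟶ B) : Hom A B := ConcreteCategory.hom f

/-! ### Free objects over weighted sets -/

/-- Formal expressions in the language of `ℓ`-algebras over a set of variables `X`. -/
inductive Term (X : Type u) : Type u
  | var : X → Term X
  | const : ℝ → Term X
  | add : Term X → Term X → Term X
  | mul : Term X → Term X → Term X
  | sup : Term X → Term X → Term X
  | inf : Term X → Term X → Term X

/-- Evaluation of an expression in an `ℓ`-algebra. -/
def Term.eval {X : Type u} {B : Type v} [CommRing B] [Lattice B] [Algebra ℝ B] (f : X → B) :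
    Term X → B
  | var x => f x
  | const r => algebraMap ℝ B r
  | add s t => s.eval f + t.eval f
  | mul s t => s.eval f * t.eval f
  | sup s t => s.eval f ⊔ t.eval f
  | inf s t => s.eval f ⊓ t.eval f

/-- Two expressions are identified when they agree under every weighted set morphism from `(X, w)`
into an object of `baℓ`. -/
def freeSetoid (X : Type u) (w : X → ℝ≥0) : Setoid (Term X) where
  r s t := ∀ (B : BAL.{u}) (f : X → B), (∀ x, norm (f x) ≤ w x) → s.eval f = t.eval f
  iseqv := ⟨fun _ _ _ _ => rfl, fun h B f hf => (h B f hf).symm,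
    fun h k B f hf => (h B f hf).trans (k B f hf)⟩

/-- The free object of `baℓ` on the weighted set `(X, w)`. -/
def Free (X : Type u) (w : X → ℝ≥0) : Type u := Quotient (freeSetoid X w)

namespace Free

variable {X : Type u} {w : X → ℝ≥0}

/-- The class of an expression. -/
def mk (t : Term X) : Free X w := Quotient.mk (freeSetoid X w) t

theorem mk_eq {s t : Term X} : (mk s : Free X w) = mk t ↔
    ∀ (B : BAL.{u}) (f : X → B), (∀ x, norm (f x) ≤ w x) → s.eval f = t.eval f :=
  Quotient.eq (r := freeSetoid X w)

theorem ind {p : Free X w → Prop} (h : ∀ t, p (mk t)) (x : Free X w) : p x :=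
  Quotient.ind (s := freeSetoid X w) h x

/-- Descent of a binary operation on expressions to the free object. -/
def map₂ (op : Term X → Term X → Term X)
    (h : ∀ (B : BAL.{u}) (f : X → B) (s s' t t' : Term X), s.eval f = s'.eval f →
      t.eval f = t'.eval f → (op s t).eval f = (op s' t').eval f) :
    Free X w → Free X w → Free X w :=
  Quotient.map₂ (sa := freeSetoid X w) (sb := freeSetoid X w) (sc := freeSetoid X w) op
    fun _ _ hs _ _ ht B f hf => h B f _ _ _ _ (hs B f hf) (ht B f hf)

instance : Add (Free X w) := ⟨map₂ .add fun B f s s' t t' h k => by simp [Term.eval, h, k]⟩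
instance : Mul (Free X w) := ⟨map₂ .mul fun B f s s' t t' h k => by simp [Term.eval, h, k]⟩
instance : Max (Free X w) := ⟨map₂ .sup fun B f s s' t t' h k => by simp [Term.eval, h, k]⟩
instance : Min (Free X w) := ⟨map₂ .inf fun B f s s' t t' h k => by simp [Term.eval, h, k]⟩
instance : Zero (Free X w) := ⟨mk (.const 0)⟩
instance : One (Free X w) := ⟨mk (.const 1)⟩
instance : Neg (Free X w) := ⟨fun x => mk (.const (-1)) * x⟩

theorem mk_add (s t : Term X) : (mk s + mk t : Free X w) = mk (.add s t) := rfl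
theorem mk_mul (s t : Term X) : (mk s * mk t : Free X w) = mk (.mul s t) := rfl
theorem mk_sup (s t : Term X) : (mk s ⊔ mk t : Free X w) = mk (.sup s t) := rfl
theorem mk_inf (s t : Term X) : (mk s ⊓ mk t : Free X w) = mk (.inf s t) := rfl
theorem zero_def : (0 : Free X w) = mk (.const 0) := rfl
theorem one_def : (1 : Free X w) = mk (.const 1) := rfl
theorem mk_neg (t : Term X) : (-mk t : Free X w) = mk (.mul (.const (-1)) t) := rfl

instance : CommRing (Free X w) where
  add_assoc x y z := by
    induction x using ind; induction y using ind; induction z using ind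
    exact mk_eq.2 fun B f _ => by simp [Term.eval, add_assoc]
  zero_add x := by
    induction x using ind
    exact mk_eq.2 fun B f _ => by simp [Term.eval]
  add_zero x := by
    induction x using ind
    exact mk_eq.2 fun B f _ => by simp [Term.eval]
  add_comm x y := by
    induction x using ind; induction y using ind
    exact mk_eq.2 fun B f _ => by simp [Term.eval, add_comm]
  mul_assoc x y z := by
    induction x using ind; induction y using ind; induction z using ind
    exact mk_eq.2 fun B f _ => by simp [Term.eval, mul_assoc]
  one_mul x := by
    induction x using ind
    exact mk_eq.2 fun B f _ => by simp [Term.eval]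
  mul_one x := by
    induction x using ind
    exact mk_eq.2 fun B f _ => by simp [Term.eval]
  mul_comm x y := by
    induction x using ind; induction y using ind
    exact mk_eq.2 fun B f _ => by simp [Term.eval, mul_comm]
  zero_mul x := by
    induction x using ind
    exact mk_eq.2 fun B f _ => by simp [Term.eval]
  mul_zero x := by
    induction x using ind
    exact mk_eq.2 fun B f _ => by simp [Term.eval]
  left_distrib x y z := by
    induction x using ind; induction y using ind; induction z using ind
    exact mk_eq.2 fun B f _ => by simp [Term.eval, mul_add]
  right_distrib x y z := by
    induction x using ind; induction y using ind; induction z using ind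
    exact mk_eq.2 fun B f _ => by simp [Term.eval, add_mul]
  neg_add_cancel x := by
    induction x using ind
    exact mk_eq.2 fun B f _ => by simp [Term.eval]
  nsmul := nsmulRec
  zsmul := zsmulRec

instance : Lattice (Free X w) := Lattice.mk'
  (fun x y => by
    induction x using ind; induction y using ind
    exact mk_eq.2 fun B f _ => by simp [Term.eval, sup_comm])
  (fun x y z => by
    induction x using ind; induction y using ind; induction z using ind
    exact mk_eq.2 fun B f _ => by simp [Term.eval, sup_assoc])
  (fun x y => by
    induction x using ind; induction y using ind
    exact mk_eq.2 fun B f _ => by simp [Term.eval, inf_comm])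
  (fun x y z => by
    induction x using ind; induction y using ind; induction z using ind
    exact mk_eq.2 fun B f _ => by simp [Term.eval, inf_assoc])
  (fun x y => by
    induction x using ind; induction y using ind
    exact mk_eq.2 fun B f _ => by simp [Term.eval])
  (fun x y => by
    induction x using ind; induction y using ind
    exact mk_eq.2 fun B f _ => by simp [Term.eval])

instance : Algebra ℝ (Free X w) := RingHom.toAlgebra
  { toFun := fun r => mk (.const r)
    map_one' := rfl
    map_zero' := rfl
    map_mul' := fun r s => mk_eq.2 fun B f _ => by simp [Term.eval]
    map_add' := fun r s => mk_eq.2 fun B f _ => by simp [Term.eval] }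

theorem algebraMap_def (r : ℝ) : algebraMap ℝ (Free X w) r = mk (.const r) := rfl

theorem mk_le {s t : Term X} : (mk s : Free X w) ≤ mk t ↔
    ∀ (B : BAL.{u}) (f : X → B), (∀ x, norm (f x) ≤ w x) → s.eval f ≤ t.eval f := by
  rw [← sup_eq_right, mk_sup, mk_eq]
  simp [Term.eval]

/-- The map that evaluates the elements of the free object along a weighted set morphism. -/
def evalMap (B : BAL.{u}) (f : X → B) (hf : ∀ x, norm (f x) ≤ w x) : Free X w → B :=
  Quotient.lift (s := freeSetoid X w) (Term.eval f) fun _ _ h => h B f hf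

/-- The unique extension of a weighted set morphism to the free object. -/
def lift (B : BAL.{u}) (f : X → B) (hf : ∀ x, norm (f x) ≤ w x) : Hom (Free X w) B where
  toFun := evalMap B f hf
  map_one' := map_one (algebraMap ℝ B)
  map_zero' := map_zero (algebraMap ℝ B)
  map_mul' x y := by induction x using ind; induction y using ind; rfl
  map_add' x y := by induction x using ind; induction y using ind; rfl
  commutes' r := rfl
  map_sup' x y := by induction x using ind; induction y using ind; rfl
  map_inf' x y := by induction x using ind; induction y using ind; rfl

theorem le_of_lift {x y : Free X w}
    (h : ∀ (B : BAL.{u}) (f : X → B) (hf : ∀ x, norm (f x) ≤ w x), lift B f hf x ≤ lift B f hf y) :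
    x ≤ y := by
  induction x using ind; induction y using ind
  exact mk_le.2 h

theorem exists_bound (t : Term X) : ∃ r : ℝ, 0 ≤ r ∧ ∀ (B : BAL.{u}) (f : X → B),
    (∀ x, norm (f x) ≤ w x) → |t.eval f| ≤ algebraMap ℝ B r := by
  induction t with
  | var x => exact ⟨w x, (w x).2, fun B f hf => (abs_le_norm _).trans (algebraMap_mono (hf x))⟩
  | const r =>
    refine ⟨|r|, abs_nonneg r, fun B f hf => abs_le'.2 ⟨algebraMap_mono (le_abs_self r), ?_⟩⟩
    change -(algebraMap ℝ B r) ≤ _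
    rw [← map_neg]
    exact algebraMap_mono (neg_le_abs r)
  | add s t hs ht =>
    obtain ⟨p, hp0, hp⟩ := hs
    obtain ⟨q, hq0, hq⟩ := ht
    refine ⟨p + q, by positivity, fun B f hf => ?_⟩
    rw [map_add]
    exact (abs_add_le _ _).trans (add_le_add (hp B f hf) (hq B f hf))
  | mul s t hs ht =>
    obtain ⟨p, hp0, hp⟩ := hs
    obtain ⟨q, hq0, hq⟩ := ht
    refine ⟨p * q, by positivity, fun B f hf => ?_⟩
    rw [map_mul]
    exact abs_mul_le (hp B f hf) (hq B f hf)
  | sup s t hs ht =>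
    obtain ⟨p, hp0, hp⟩ := hs
    obtain ⟨q, hq0, hq⟩ := ht
    refine ⟨p + q, by positivity, fun B f hf => ?_⟩
    have h1 := (hp B f hf).trans (algebraMap_mono (le_add_of_nonneg_right hq0))
    have h2 := (hq B f hf).trans (algebraMap_mono (le_add_of_nonneg_left hp0))
    exact abs_le'.2 ⟨sup_le ((le_abs_self _).trans h1) ((le_abs_self _).trans h2),
      (neg_le_neg le_sup_left).trans ((neg_le_abs _).trans h1)⟩
  | inf s t hs ht =>
    obtain ⟨p, hp0, hp⟩ := hs
    obtain ⟨q, hq0, hq⟩ := ht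
    refine ⟨p + q, by positivity, fun B f hf => ?_⟩
    have h1 := (hp B f hf).trans (algebraMap_mono (le_add_of_nonneg_right hq0))
    have h2 := (hq B f hf).trans (algebraMap_mono (le_add_of_nonneg_left hp0))
    refine abs_le'.2 ⟨inf_le_left.trans ((le_abs_self _).trans h1), ?_⟩
    rw [neg_le]
    exact le_inf (neg_le.1 ((neg_le_abs _).trans h1)) (neg_le.1 ((neg_le_abs _).trans h2))

instance : IsBal (Free X w) where
  add_right a b h c := le_of_lift fun B f hf => by
    rw [map_add, map_add]; exact add_le_add_left ((lift B f hf).map_mono h) _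
  mul_nonneg a b ha hb := le_of_lift fun B f hf => by
    have h1 := (lift B f hf).map_mono ha
    have h2 := (lift B f hf).map_mono hb
    rw [map_zero] at h1 h2
    rw [map_mul, map_zero]; exact mul_nonneg h1 h2
  smul_nonneg r a hr ha := le_of_lift fun B f hf => by
    have h1 := (lift B f hf).map_mono ha
    rw [map_zero] at h1
    rw [map_smul, map_zero]; exact IsBal.smul_nonneg r _ hr h1
  bounded a := by
    induction a using ind with | h t => ?_
    obtain ⟨r, -, hr⟩ := exists_bound (w := w) t
    obtain ⟨n, hn⟩ := exists_nat_ge r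
    refine ⟨n, le_of_lift fun B f hf => ?_⟩
    rw [map_nsmul, map_one]
    refine (le_abs_self _).trans ((hr B f hf).trans ((algebraMap_mono hn).trans ?_))
    simp
  archimedean a b h := le_of_lift fun B f hf => by
    rw [map_zero]
    refine IsBal.archimedean _ (lift B f hf b) fun n => ?_
    rw [← map_nsmul]; exact (lift B f hf).map_mono (h n)

/-- The canonical map into the free object. -/
def of (x : X) : Free X w := mk (.var x)

@[simp] theorem lift_of (B : BAL.{u}) (f : X → B) (hf : ∀ x, norm (f x) ≤ w x) (x : X) :
    lift B f hf (of x) = f x := rfl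

theorem norm_of_le (x : X) : norm (of x : Free X w) ≤ w x := by
  refine norm_le (w x).2 (abs_le'.2 ⟨?_, ?_⟩)
  · exact mk_le.2 fun B f hf => (le_abs_self _).trans
      ((abs_le_norm _).trans (algebraMap_mono (hf x)))
  · refine le_of_lift fun B f hf => ?_
    rw [map_neg, lift_of, Hom.map_algebraMap]
    exact (neg_le_abs _).trans ((abs_le_norm _).trans (algebraMap_mono (hf x)))

theorem hom_ext {B : Type*} [CommRing B] [Lattice B] [Algebra ℝ B] {f g : Hom (Free X w) B}
    (h : ∀ x, f (of x) = g (of x)) : f = g := by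
  refine Hom.ext' fun x => ?_
  induction x using ind with | h t => ?_
  induction t with
  | var x => exact h x
  | const r => exact (f.map_algebraMap r).trans (g.map_algebraMap r).symm
  | add s t hs ht => rw [← mk_add, map_add, map_add, hs, ht]
  | mul s t hs ht => rw [← mk_mul, map_mul, map_mul, hs, ht]
  | sup s t hs ht => rw [← mk_sup, map_sup, map_sup, hs, ht]
  | inf s t hs ht => rw [← mk_inf, map_inf, map_inf, hs, ht]

end Free

/-! ### `ℓ`-ideals and quotients -/

/-- `ℓ`-ideals of an `ℓ`-algebra. -/
structure LIdeal (A : Type*) [CommRing A] [Lattice A] where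
  ideal : Ideal A
  solid : ∀ a b : A, |a| ≤ |b| → b ∈ ideal → a ∈ ideal

namespace LIdeal

variable {A : Type*} [CommRing A] [Lattice A]

/-- The quotient of an `ℓ`-algebra by an `ℓ`-ideal. -/
def Quot (I : LIdeal A) : Type _ := A ⧸ I.ideal

variable (I : LIdeal A)

instance : CommRing I.Quot := inferInstanceAs (CommRing (A ⧸ I.ideal))

instance [Algebra ℝ A] : Algebra ℝ I.Quot := inferInstanceAs (Algebra ℝ (A ⧸ I.ideal))

/-- The class of an element in the quotient. -/
def cls (a : A) : I.Quot := Ideal.Quotient.mk I.ideal a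

theorem cls_eq {a b : A} : I.cls a = I.cls b ↔ a - b ∈ I.ideal := Ideal.Quotient.mk_eq_mk_iff_sub_mem a b

theorem cls_add (a b : A) : I.cls (a + b) = I.cls a + I.cls b := rfl
theorem cls_mul (a b : A) : I.cls (a * b) = I.cls a * I.cls b := rfl
theorem cls_zero : I.cls 0 = 0 := rfl
theorem cls_one : I.cls 1 = 1 := rfl
theorem cls_sub (a b : A) : I.cls (a - b) = I.cls a - I.cls b := rfl

theorem cls_nsmul (n : ℕ) (a : A) : I.cls (n • a) = n • I.cls a :=
  map_nsmul (Ideal.Quotient.mk I.ideal) n a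

theorem cls_smul [Algebra ℝ A] (r : ℝ) (a : A) : I.cls (r • a) = r • I.cls a := rfl

theorem cls_surjective (x : I.Quot) : ∃ a, I.cls a = x := Ideal.Quotient.mk_surjective x

theorem ind {p : I.Quot → Prop} (h : ∀ a, p (I.cls a)) (x : I.Quot) : p x := by
  obtain ⟨a, rfl⟩ := I.cls_surjective x; exact h a

theorem abs_mem [IsOrderedAddMonoid A] {a : A} : |a| ∈ I.ideal ↔ a ∈ I.ideal :=
  ⟨fun h => I.solid a |a| (by rw [abs_abs]) h, fun h => I.solid |a| a (by rw [abs_abs]) h⟩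

/-- The least `ℓ`-ideal with property `P` that contains `S`, when `P` is closed under
intersections. -/
def least (P : LIdeal A → Prop) (S : Set A) : LIdeal A where
  ideal := sInf {J | ∃ I : LIdeal A, P I ∧ S ⊆ I.ideal ∧ I.ideal = J}
  solid a b hab hb := by
    rw [Submodule.mem_sInf] at hb ⊢
    rintro _ ⟨I, hI, hS, rfl⟩
    exact I.solid a b hab (hb _ ⟨I, hI, hS, rfl⟩)

theorem mem_least {P : LIdeal A → Prop} {S : Set A} {a : A} :
    a ∈ (least P S).ideal ↔ ∀ I : LIdeal A, P I → S ⊆ I.ideal → a ∈ I.ideal := by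
  refine Submodule.mem_sInf.trans ⟨fun h I hI hS => h _ ⟨I, hI, hS, rfl⟩, ?_⟩
  rintro h _ ⟨I, hI, hS, rfl⟩
  exact h I hI hS

variable [IsOrderedAddMonoid A]

theorem sup_sub_sup_mem {a a' b b' : A} (h : a - a' ∈ I.ideal) (k : b - b' ∈ I.ideal) :
    a ⊔ b - a' ⊔ b' ∈ I.ideal := by
  have h1 : a ⊔ b - a' ⊔ b ∈ I.ideal := I.solid _ _ (abs_sup_sub_sup_le_abs a a' b) h
  have h2 : a' ⊔ b - a' ⊔ b' ∈ I.ideal := by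
    rw [sup_comm a', sup_comm a']
    exact I.solid _ _ (abs_sup_sub_sup_le_abs b b' a') k
  simpa using I.ideal.add_mem h1 h2

theorem inf_sub_inf_mem {a a' b b' : A} (h : a - a' ∈ I.ideal) (k : b - b' ∈ I.ideal) :
    a ⊓ b - a' ⊓ b' ∈ I.ideal := by
  have h1 : a ⊓ b - a' ⊓ b ∈ I.ideal := I.solid _ _ (abs_inf_sub_inf_le_abs a a' b) h
  have h2 : a' ⊓ b - a' ⊓ b' ∈ I.ideal := by
    rw [inf_comm a', inf_comm a']
    exact I.solid _ _ (abs_inf_sub_inf_le_abs b b' a') k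
  simpa using I.ideal.add_mem h1 h2

/-- Binary joins in the quotient. -/
def qsup : I.Quot → I.Quot → I.Quot :=
  Quotient.map₂ (· ⊔ ·) fun _ _ h _ _ k =>
    (Submodule.quotientRel_def _).2 (I.sup_sub_sup_mem
      ((Submodule.quotientRel_def _).1 h) ((Submodule.quotientRel_def _).1 k))

/-- Binary meets in the quotient. -/
def qinf : I.Quot → I.Quot → I.Quot :=
  Quotient.map₂ (· ⊓ ·) fun _ _ h _ _ k =>
    (Submodule.quotientRel_def _).2 (I.inf_sub_inf_mem
      ((Submodule.quotientRel_def _).1 h) ((Submodule.quotientRel_def _).1 k))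

instance : Lattice I.Quot := @Lattice.mk' _ ⟨I.qsup⟩ ⟨I.qinf⟩
  (I.ind fun a => I.ind fun b => congrArg I.cls (sup_comm a b))
  (I.ind fun a => I.ind fun b => I.ind fun c => congrArg I.cls (sup_assoc a b c))
  (I.ind fun a => I.ind fun b => congrArg I.cls (inf_comm a b))
  (I.ind fun a => I.ind fun b => I.ind fun c => congrArg I.cls (inf_assoc a b c))
  (I.ind fun a => I.ind fun b => congrArg I.cls (sup_inf_self (a := a) (b := b)))
  (I.ind fun a => I.ind fun b => congrArg I.cls (inf_sup_self (a := a) (b := b)))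

theorem cls_sup (a b : A) : I.cls (a ⊔ b) = I.cls a ⊔ I.cls b := rfl
theorem cls_inf (a b : A) : I.cls (a ⊓ b) = I.cls a ⊓ I.cls b := rfl

theorem cls_mono {a b : A} (h : a ≤ b) : I.cls a ≤ I.cls b := by
  rw [← sup_eq_right, ← cls_sup, sup_eq_right.2 h]

theorem cls_le_cls {a b : A} : I.cls a ≤ I.cls b ↔ (a - b) ⊔ 0 ∈ I.ideal := by
  rw [← sup_eq_right, ← cls_sup, cls_eq, sup_sub, sub_self]

/-- An `ℓ`-ideal is archimedean when the quotient by it is archimedean. -/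
def IsArchimedean (I : LIdeal A) : Prop :=
  ∀ x y : I.Quot, (∀ n : ℕ, n • x ≤ y) → x ≤ 0

theorem isArchimedean_iff : I.IsArchimedean ↔
    ∀ a b : A, (∀ n : ℕ, (n • a - b) ⊔ 0 ∈ I.ideal) → a ⊔ 0 ∈ I.ideal := by
  constructor
  · intro h a b hab
    have := h (I.cls a) (I.cls b) fun n => by rw [← cls_nsmul, cls_le_cls]; exact hab n
    rw [← cls_zero, cls_le_cls, sub_zero] at this
    exact this
  · intro h x y hxy
    induction x using I.ind with | h a => ?_
    induction y using I.ind with | h b => ?_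
    rw [← cls_zero, cls_le_cls, sub_zero]
    refine h _ b fun n => ?_
    rw [← cls_le_cls, cls_nsmul]; exact hxy n

/-- The `ℓ`-ideal generated by `S`. -/
def gen (S : Set A) : LIdeal A := least (fun _ => True) S

/-- The archimedean `ℓ`-ideal generated by `S`. -/
def archGen (S : Set A) : LIdeal A := least IsArchimedean S

theorem archGen_isArchimedean (S : Set A) : (archGen S).IsArchimedean := by
  rw [isArchimedean_iff]
  intro a b h
  refine mem_least.2 fun I hI hS => (I.isArchimedean_iff.1 hI) a b fun n => ?_
  exact mem_least.1 (h n) I hI hS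

end LIdeal

section Quot

variable {A : Type*} [CommRing A] [Lattice A] [Algebra ℝ A] [IsBal A]

instance (I : LIdeal A) : IsOrderedAddMonoid I.Quot where
  add_le_add_left x y h z := by
    induction x using I.ind; induction y using I.ind; induction z using I.ind
    rw [← I.cls_add, ← I.cls_add, I.cls_le_cls, add_sub_add_right_eq_sub, ← I.cls_le_cls]
    exact h

theorem LIdeal.quot_smul_nonneg (I : LIdeal A) {r : ℝ} {x : I.Quot} (hr : 0 ≤ r) (hx : 0 ≤ x) :
    0 ≤ r • x := by
  rw [← sup_eq_right] at hx
  induction x using I.ind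
  rw [← hx, ← I.cls_zero, ← I.cls_sup, ← I.cls_smul]
  exact I.cls_mono (IsBal.smul_nonneg r _ hr le_sup_left)

theorem LIdeal.isBal_quot (I : LIdeal A) (hI : I.IsArchimedean) : IsBal I.Quot where
  add_right _ _ h _ := add_le_add_left h _
  mul_nonneg x y hx hy := by
    rw [← sup_eq_right] at hx hy
    induction x using I.ind; induction y using I.ind
    rw [← hx, ← hy, ← I.cls_zero, ← I.cls_sup, ← I.cls_sup, ← I.cls_mul]
    exact I.cls_mono (mul_nonneg le_sup_left le_sup_left)
  smul_nonneg r x hr hx := I.quot_smul_nonneg hr hx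
  bounded x := by
    induction x using I.ind with | h a => ?_
    obtain ⟨n, hn⟩ := IsBal.bounded a
    exact ⟨n, by rw [← I.cls_one, ← I.cls_nsmul]; exact I.cls_mono hn⟩
  archimedean := hI

/-- The quotient map. -/
def LIdeal.proj (I : LIdeal A) : Hom A I.Quot where
  toAlgHom := Ideal.Quotient.mkₐ ℝ I.ideal
  map_sup' _ _ := rfl
  map_inf' _ _ := rfl

theorem LIdeal.proj_apply (I : LIdeal A) (a : A) : I.proj a = I.cls a := rfl

/-- The kernel of a morphism. -/
def Hom.ker {B : Type*} [CommRing B] [Lattice B] [Algebra ℝ B] [IsBal B] (f : Hom A B) :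
    LIdeal A where
  ideal := RingHom.ker f
  solid a b hab hb := by
    rw [RingHom.mem_ker] at hb ⊢
    have h := f.map_mono hab
    rw [f.map_abs, f.map_abs, hb, abs_zero] at h
    have h1 : f a ≤ 0 := (le_abs_self _).trans h
    have h2 : -f a ≤ 0 := (neg_le_abs _).trans h
    exact le_antisymm h1 (by simpa using h2)

theorem Hom.mem_ker {A B : Type*} [CommRing A] [Lattice A] [Algebra ℝ A]
    [CommRing B] [Lattice B] [Algebra ℝ B] [IsBal B] (f : Hom A B)
    {a : A} : a ∈ f.ker.ideal ↔ f a = 0 := Iff.rfl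

theorem Hom.ker_isArchimedean {B : Type*} [CommRing B] [Lattice B] [Algebra ℝ B] [IsBal B]
    (f : Hom A B) : f.ker.IsArchimedean := by
  rw [LIdeal.isArchimedean_iff]
  intro a b h
  simp only [Hom.mem_ker, map_sup, map_sub, map_nsmul, map_zero, sup_eq_right,
    sub_nonpos] at h ⊢
  exact IsBal.archimedean _ _ h

/-- The morphism induced on the quotient. -/
def LIdeal.desc (I : LIdeal A) {B : Type*} [CommRing B] [Lattice B] [Algebra ℝ B]
    (f : Hom A B) (h : ∀ a ∈ I.ideal, f a = 0) : Hom I.Quot B where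
  toAlgHom := Ideal.Quotient.liftₐ I.ideal f.toAlgHom h
  map_sup' x y := by
    induction x using I.ind; induction y using I.ind
    exact map_sup f _ _
  map_inf' x y := by
    induction x using I.ind; induction y using I.ind
    exact map_inf f _ _

@[simp] theorem LIdeal.desc_cls (I : LIdeal A) {B : Type*} [CommRing B] [Lattice B] [Algebra ℝ B]
    (f : Hom A B) (h : ∀ a ∈ I.ideal, f a = 0) (a : A) : I.desc f h (I.cls a) = f a := rfl

end Quot

/-! ### The endofunctor `H` -/

/-- The weight function `w_A(a) = max {‖a‖, 1}`. -/
def weight {A : Type*} [CommRing A] [Lattice A] [Algebra ℝ A] (a : A) : ℝ≥0 :=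
  ⟨max (norm a) 1, zero_le_one.trans (le_max_right _ _)⟩

/-- The elements by which the free object on `(A, w_A)` is factored. -/
inductive BoxRel (A : BAL.{u}) : Free A weight → Prop
  | inf (a b : A) : BoxRel A (Free.of (a ⊓ b) - Free.of a ⊓ Free.of b)
  | const (r : ℝ) : BoxRel A (Free.of (algebraMap ℝ A r) - algebraMap ℝ _ r
      - (1 - algebraMap ℝ _ r) * Free.of 0)
  | pos (a : A) : BoxRel A (Free.of (a ⊔ 0) - Free.of a ⊔ 0)
  | add (a : A) (r : ℝ) : BoxRel A (Free.of (a + algebraMap ℝ A r) - Free.of a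
      - Free.of (algebraMap ℝ A r) + Free.of 0)
  | smul (r : ℝ) (hr : 0 ≤ r) (a : A) : BoxRel A (Free.of (r • a)
      - Free.of (algebraMap ℝ A r) * Free.of a)

/-- The archimedean `ℓ`-ideal `I_A` of the free object on `(A, w_A)`. -/
def boxIdeal (A : BAL.{u}) : LIdeal (Free A weight) := LIdeal.archGen {x | BoxRel A x}

/-- The object `H(A)`. -/
def HObj (A : BAL.{u}) : BAL.{u} :=
  { carrier := (boxIdeal A).Quot
    isBal := (boxIdeal A).isBal_quot (LIdeal.archGen_isArchimedean _) }

/-- The quotient map from the free object on `(A, w_A)` to `H(A)`. -/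
def boxProj (A : BAL.{u}) : Hom (Free A weight) (HObj A) := (boxIdeal A).proj

/-- The map `h_A : A → H(A)`, `a ↦ □_a`. -/
def box {A : BAL.{u}} (a : A) : HObj A := boxProj A (Free.of a)

theorem norm_box_le {A : BAL.{u}} (a : A) : norm (box a) ≤ weight a :=
  norm_le (weight a).2 ((boxProj A).abs_map_le
    ((abs_le_norm _).trans (algebraMap_mono (Free.norm_of_le a))))

theorem proj_boxRel {A : BAL.{u}} {x : Free A weight} (h : BoxRel A x) :
    boxProj A x = 0 :=
  Ideal.Quotient.eq_zero_iff_mem.2 (LIdeal.mem_least.2 fun _ _ hS => hS h)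

/-- The universal property of `H(A)`. -/
def HLift {A B : BAL.{u}} (g : A → B) (hw : ∀ a, norm (g a) ≤ weight a)
    (hrel : ∀ x, BoxRel A x → Free.lift B g hw x = 0) : HObj A ⟶ B :=
  (boxIdeal A).desc (Free.lift B g hw) fun _ ha =>
    (LIdeal.mem_least.1 ha) (Free.lift B g hw).ker (Hom.ker_isArchimedean _)
      fun x hx => (Hom.mem_ker _).2 (hrel x hx)

theorem HLift_box {A B : BAL.{u}} (g : A → B) (hw : ∀ a, norm (g a) ≤ weight a)
    (hrel : ∀ x, BoxRel A x → Free.lift B g hw x = 0) (a : A) :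
    HLift g hw hrel (box a) = g a := rfl

theorem H_hom_ext {A B : BAL.{u}} {f g : HObj A ⟶ B}
    (h : ∀ a : A, f (box a) = g (box a)) : f = g := by
  have key : (BAL.hom f).comp (boxProj A) = (BAL.hom g).comp (boxProj A) := Free.hom_ext h
  refine Hom.ext' (A := HObj A) fun x => ?_
  obtain ⟨a, rfl⟩ := (boxIdeal A).cls_surjective x
  exact congrArg (fun k : Hom (Free A weight) B => k a) key

theorem weight_map_le {A B : BAL.{u}} (f : A ⟶ B) (a : A) : weight (f a) ≤ weight a :=
  max_le (norm_le (weight a).2 ((BAL.hom f).abs_map_le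
    ((abs_le_norm a).trans (algebraMap_mono (le_max_left _ _))))) (le_max_right _ _)

/-- A map out of `A` that satisfies the relations of the elements `□_a`. -/
structure IsBox {A B : Type*} [CommRing A] [Lattice A] [Algebra ℝ A]
    [CommRing B] [Lattice B] [Algebra ℝ B] (g : A → B) : Prop where
  inf (a b : A) : g (a ⊓ b) = g a ⊓ g b
  const (r : ℝ) : g (algebraMap ℝ A r) = algebraMap ℝ B r + (1 - algebraMap ℝ B r) * g 0
  pos (a : A) : g (a ⊔ 0) = g a ⊔ 0
  add (a : A) (r : ℝ) : g (a + algebraMap ℝ A r) = g a + g (algebraMap ℝ A r) - g 0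
  smul (r : ℝ) (hr : 0 ≤ r) (a : A) : g (r • a) = g (algebraMap ℝ A r) * g a

theorem IsBox.lift_eq_zero {A B : BAL.{u}} {g : A → B} (h : IsBox g)
    (hw : ∀ a, norm (g a) ≤ weight a) (x : Free A weight) (hx : BoxRel A x) :
    Free.lift B g hw x = 0 := by
  cases hx with
  | inf a b => simp [h.inf]
  | const r =>
    simp only [map_sub, map_mul, map_one, Free.lift_of, Hom.map_algebraMap]
    rw [h.const]; ring
  | pos a => simp [h.pos]
  | add a r =>
    simp only [map_sub, map_add, Free.lift_of]
    rw [h.add]; ring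
  | smul r hr a =>
    simp only [map_sub, map_mul, Free.lift_of]
    rw [h.smul r hr, sub_self]

theorem isBox_box (A : BAL.{u}) : IsBox (box : A → HObj A) where
  inf a b := by
    have := proj_boxRel (BoxRel.inf a b)
    simp only [map_sub, map_inf, sub_eq_zero] at this
    exact this
  const r := by
    have := proj_boxRel (A := A) (BoxRel.const r)
    simp only [map_sub, map_mul, map_one, Hom.map_algebraMap] at this
    rw [sub_sub, sub_eq_zero] at this
    exact this
  pos a := by
    have := proj_boxRel (BoxRel.pos a)
    simp only [map_sub, map_sup, map_zero, sub_eq_zero] at this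
    exact this
  add a r := by
    have := proj_boxRel (BoxRel.add a r)
    simp only [map_sub, map_add] at this
    rw [sub_sub, sub_add, sub_eq_zero] at this
    exact this
  smul r hr a := by
    have := proj_boxRel (BoxRel.smul r hr a)
    simp only [map_sub, map_mul, sub_eq_zero] at this
    exact this

theorem IsBox.comp {A A' B : BAL.{u}} {g : A' → B} (h : IsBox g) (f : A ⟶ A') :
    IsBox (fun a => g (f a)) where
  inf a b := by rw [map_inf, h.inf]
  const r := by
    have e : f (algebraMap ℝ A r) = algebraMap ℝ A' r := (BAL.hom f).map_algebraMap r
    rw [e, h.const, map_zero]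
  pos a := by rw [map_sup, map_zero, h.pos]
  add a r := by
    have e : f (algebraMap ℝ A r) = algebraMap ℝ A' r := (BAL.hom f).map_algebraMap r
    rw [map_add, e, h.add, map_zero]
  smul r hr a := by
    have e : f (algebraMap ℝ A r) = algebraMap ℝ A' r := (BAL.hom f).map_algebraMap r
    rw [map_smul, e, h.smul r hr]

/-- The endofunctor `H` of `baℓ`. -/
def H : BAL.{u} ⥤ BAL.{u} where
  obj := HObj
  map f := HLift (fun a => box (f a))
    (fun a => (norm_box_le _).trans (weight_map_le f a))
    (((isBox_box _).comp f).lift_eq_zero _)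
  map_id _ := H_hom_ext fun _ => rfl
  map_comp _ _ := H_hom_ext fun _ => rfl

theorem H_map_box {A B : BAL.{u}} (f : A ⟶ B) (a : A) : H.map f (box a) = box (f a) := rfl

/-! ### The Yosida space -/

instance : IsBal ℝ where
  add_right a b h c := by linarith
  mul_nonneg _ _ := mul_nonneg
  smul_nonneg _ _ := mul_nonneg
  bounded a := by
    obtain ⟨n, hn⟩ := exists_nat_ge a
    exact ⟨n, by simpa using hn⟩
  archimedean a b h := by
    by_contra! ha
    obtain ⟨n, hn⟩ := exists_lt_nsmul ha b
    exact absurd (h n) (not_le.2 hn)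

/-- The points of the Yosida space `Y_A`: the maximal `ℓ`-ideals of `A`. -/
@[ext]
structure Yosida (A : Type*) [CommRing A] [Lattice A] where
  toLIdeal : LIdeal A
  ne_top : toLIdeal.ideal ≠ ⊤
  maximal : ∀ J : LIdeal A, J.ideal ≠ ⊤ → toLIdeal.ideal ≤ J.ideal → J.ideal = toLIdeal.ideal

namespace Yosida

section Points

variable {A : Type*} [CommRing A] [Lattice A]

/-- The ideal underlying a point of the Yosida space. -/
def ideal (M : Yosida A) : Ideal A := M.toLIdeal.ideal

theorem ext' {M N : Yosida A} (h : ∀ a, a ∈ M.ideal ↔ a ∈ N.ideal) : M = N := by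
  obtain ⟨⟨I, hI⟩, _, _⟩ := M
  obtain ⟨⟨J, hJ⟩, _, _⟩ := N
  obtain rfl : I = J := Ideal.ext h
  rfl

theorem one_notMem (M : Yosida A) : (1 : A) ∉ M.ideal := fun h =>
  M.ne_top ((Ideal.eq_top_iff_one _).2 h)

variable [Algebra ℝ A]

theorem algebraMap_mem (M : Yosida A) {r : ℝ} : algebraMap ℝ A r ∈ M.ideal ↔ r = 0 := by
  refine ⟨fun h => ?_, by rintro rfl; simp⟩
  by_contra hr
  refine M.one_notMem ?_
  have := M.ideal.mul_mem_left (algebraMap ℝ A r⁻¹) h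
  rwa [← map_mul, inv_mul_cancel₀ hr, map_one] at this

/-- An `ℓ`-ideal with real quotient is maximal. -/
def ofReal (I : LIdeal A) (h1 : (1 : A) ∉ I.ideal)
    (h : ∀ a, ∃ r : ℝ, a - algebraMap ℝ A r ∈ I.ideal) : Yosida A where
  toLIdeal := I
  ne_top ht := h1 ((Ideal.eq_top_iff_one _).1 ht)
  maximal J hJ hIJ := by
    refine le_antisymm (fun a ha => ?_) hIJ
    obtain ⟨r, hr⟩ := h a
    have hrJ : algebraMap ℝ A r ∈ J.ideal := by
      have := J.ideal.sub_mem ha (hIJ hr)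
      rwa [sub_sub_cancel] at this
    by_cases hr0 : r = 0
    · simpa [hr0] using hr
    · refine absurd ((Ideal.eq_top_iff_one _).2 ?_) hJ
      have := J.ideal.mul_mem_left (algebraMap ℝ A r⁻¹) hrJ
      rwa [← map_mul, inv_mul_cancel₀ hr0, map_one] at this

variable [IsBal A]

theorem exists_one_le (M : Yosida A) {x : A} (hx : x ∉ M.ideal) :
    ∃ m ∈ M.ideal, ∃ n : ℕ, 1 ≤ m + n • |x| := by
  let J : LIdeal A :=
    { ideal :=
        { carrier := {y | ∃ m ∈ M.ideal, ∃ n : ℕ, |y| ≤ m + n • |x|}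
          zero_mem' := ⟨0, M.ideal.zero_mem, 0, by simp⟩
          add_mem' := by
            rintro y z ⟨m, hm, n, h⟩ ⟨m', hm', n', h'⟩
            refine ⟨m + m', M.ideal.add_mem hm hm', n + n', (abs_add_le y z).trans ?_⟩
            calc |y| + |z| ≤ _ := add_le_add h h'
              _ = _ := by rw [add_smul]; abel
          smul_mem' := by
            rintro c y ⟨m, hm, n, h⟩
            obtain ⟨k, hk⟩ := IsBal.bounded |c|
            refine ⟨k • m, M.ideal.nsmul_mem hm k, k * n, ?_⟩
            calc |c * y| ≤ (k • (1 : A)) * (m + n • |x|) := abs_mul_le hk h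
              _ = _ := by rw [smul_one_mul, nsmul_add, mul_smul] }
      solid := by
        rintro a b hab ⟨m, hm, n, h⟩
        exact ⟨m, hm, n, hab.trans h⟩ }
  by_cases hJ : J.ideal = ⊤
  · obtain ⟨m, hm, n, h⟩ : (1 : A) ∈ J.ideal := hJ ▸ Submodule.mem_top
    exact ⟨m, hm, n, (le_abs_self 1).trans h⟩
  · refine absurd ?_ hx
    have hle : M.ideal ≤ J.ideal := fun m hm => ⟨|m|, M.toLIdeal.abs_mem.2 hm, 0, by simp⟩
    have : x ∈ J.ideal := ⟨0, M.ideal.zero_mem, 1, by simp⟩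
    rwa [M.maximal J hJ hle] at this

theorem pos_or_neg_mem (M : Yosida A) (c : A) : c ⊔ 0 ∈ M.ideal ∨ -c ⊔ 0 ∈ M.ideal := by
  by_contra! hcon
  obtain ⟨m, hm, n, h⟩ := M.exists_one_le hcon.1
  obtain ⟨m', hm', n', h'⟩ := M.exists_one_le hcon.2
  rw [abs_of_nonneg le_sup_right] at h h'
  set p := c ⊔ 0 with hp
  set q := -c ⊔ 0 with hq
  have hp0 : 0 ≤ p := le_sup_right
  have hq0 : 0 ≤ q := le_sup_right
  have hpq : p ⊓ q = 0 := posPart_inf_negPart_eq_zero c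
  set N := n + n' + 1 with hN
  set d := 1 - (|m| + |m'|) with hd
  have hmp : d ≤ N • p := by
    rw [hd, sub_le_iff_le_add']
    refine h.trans (add_le_add ((le_abs_self m).trans (le_add_of_nonneg_right (abs_nonneg _))) ?_)
    exact nsmul_le_nsmul_left hp0 (by omega)
  have hmq : d ≤ N • q := by
    rw [hd, sub_le_iff_le_add']
    refine h'.trans (add_le_add ((le_abs_self m').trans (le_add_of_nonneg_left (abs_nonneg _))) ?_)
    exact nsmul_le_nsmul_left hq0 (by omega)
  have hN0 : (N : ℝ) ≠ 0 := by positivity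
  have scale : ∀ x : A, d ≤ N • x → (N : ℝ)⁻¹ • d ≤ x := fun x hx => by
    have := IsBal.smul_nonneg (N : ℝ)⁻¹ _ (by positivity) (sub_nonneg.2 hx)
    rw [smul_sub, ← Nat.cast_smul_eq_nsmul ℝ, smul_smul, inv_mul_cancel₀ hN0, one_smul] at this
    exact sub_nonneg.1 this
  have h0 : (N : ℝ)⁻¹ • d ≤ 0 := hpq ▸ le_inf (scale p hmp) (scale q hmq)
  have h1 : d ≤ 0 := by
    have := IsBal.smul_nonneg (N : ℝ) _ (by positivity) (neg_nonneg.2 h0)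
    rw [smul_neg, smul_smul, mul_inv_cancel₀ hN0, one_smul] at this
    exact neg_nonneg.1 this
  refine M.one_notMem (M.toLIdeal.solid 1 (|m| + |m'|) ?_
    (M.ideal.add_mem (M.toLIdeal.abs_mem.2 hm) (M.toLIdeal.abs_mem.2 hm')))
  rw [abs_of_nonneg zero_le_one, abs_of_nonneg (add_nonneg (abs_nonneg _) (abs_nonneg _))]
  exact sub_nonpos.1 h1

theorem le_of_cls_le (M : Yosida A) {r s : ℝ}
    (h : M.toLIdeal.cls (algebraMap ℝ A r) ≤ M.toLIdeal.cls (algebraMap ℝ A s)) : r ≤ s := by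
  rw [LIdeal.cls_le_cls, ← map_sub, ← map_zero (algebraMap ℝ A), ← algebraMap_sup] at h
  have := M.algebraMap_mem.1 h
  simpa using this

/-- `A / M` is the field of real numbers. -/
theorem exists_real (M : Yosida A) (a : A) : ∃ r : ℝ, a - algebraMap ℝ A r ∈ M.ideal := by
  let q := M.toLIdeal.cls
  let L : Set ℝ := {r | q (algebraMap ℝ A r) ≤ q a}
  obtain ⟨R, hR⟩ := exists_abs_le a
  have hne : L.Nonempty := ⟨-R, M.toLIdeal.cls_mono (by
    rw [map_neg]; exact neg_le.1 ((neg_le_abs a).trans hR))⟩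
  have hbd : BddAbove L := ⟨R, fun r hr =>
    M.le_of_cls_le (le_trans hr (M.toLIdeal.cls_mono ((le_abs_self a).trans hR)))⟩
  refine ⟨sSup L, ?_⟩
  by_contra hcon
  obtain ⟨m, hm, n, h⟩ := M.exists_one_le hcon
  set s := sSup L with hs
  set x := a - algebraMap ℝ A s with hx
  set δ : ℝ := ((n : ℝ) + 1)⁻¹ with hδ
  have hδ0 : 0 < δ := by positivity
  have hqx : q (algebraMap ℝ A δ) ≤ |q x| := by
    have h1 : q 1 ≤ q ((n + 1) • |x|) := by
      have hm0 : q m = 0 := by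
        rw [← M.toLIdeal.cls_zero]; exact M.toLIdeal.cls_eq.2 (by rw [sub_zero]; exact hm)
      have := M.toLIdeal.cls_mono h
      rw [M.toLIdeal.cls_add] at this
      change q 1 ≤ q m + _ at this
      rw [hm0, zero_add] at this
      exact this.trans (M.toLIdeal.cls_mono
        (nsmul_le_nsmul_left (abs_nonneg x) (Nat.le_succ n)))
    have h2 : 0 ≤ δ • (q ((n + 1) • |x|) - q 1) :=
      M.toLIdeal.quot_smul_nonneg hδ0.le (sub_nonneg.2 h1)
    have e1 : δ • q ((n + 1) • |x|) = |q x| := by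
      change δ • M.toLIdeal.cls _ = _
      rw [← M.toLIdeal.cls_smul, ← Nat.cast_smul_eq_nsmul ℝ, smul_smul]
      have : δ * ((n + 1 : ℕ) : ℝ) = 1 := by
        push_cast; exact inv_mul_cancel₀ (by positivity)
      rw [this, one_smul]
      rfl
    have e2 : δ • q 1 = q (algebraMap ℝ A δ) := by
      change δ • M.toLIdeal.cls _ = _
      rw [← M.toLIdeal.cls_smul, ← Algebra.algebraMap_eq_smul_one]
    rw [smul_sub, e1, e2] at h2
    exact sub_nonneg.1 h2
  rcases M.pos_or_neg_mem x with hle | hge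
  · have hx0 : q x ≤ 0 := by
      rw [← M.toLIdeal.cls_zero]; exact M.toLIdeal.cls_le_cls.2 (by rw [sub_zero]; exact hle)
    rw [abs_of_nonpos hx0] at hqx
    have key : q a ≤ q (algebraMap ℝ A (s - δ)) := by
      have e : q (algebraMap ℝ A (s - δ)) = q a - q x - q (algebraMap ℝ A δ) := by
        change _ = M.toLIdeal.cls _ - M.toLIdeal.cls _ - M.toLIdeal.cls _
        rw [← M.toLIdeal.cls_sub, ← M.toLIdeal.cls_sub, hx, sub_sub_cancel, map_sub]
      rw [e, le_sub_comm, sub_sub_cancel_left]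
      exact hqx
    have : s ≤ s - δ := csSup_le hne fun r hr => M.le_of_cls_le (le_trans hr key)
    linarith
  · have hx0 : 0 ≤ q x := by
      rw [← M.toLIdeal.cls_zero]; exact M.toLIdeal.cls_le_cls.2 (by rw [zero_sub]; exact hge)
    rw [abs_of_nonneg hx0] at hqx
    have key : s + δ ∈ L := by
      have e : q (algebraMap ℝ A (s + δ)) = q a - q x + q (algebraMap ℝ A δ) := by
        change _ = M.toLIdeal.cls _ - M.toLIdeal.cls _ + M.toLIdeal.cls _
        rw [← M.toLIdeal.cls_sub, ← M.toLIdeal.cls_add, hx, sub_sub_cancel, map_add]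
      change q (algebraMap ℝ A (s + δ)) ≤ q a
      rw [e, sub_add, sub_le_self_iff, sub_nonneg]
      exact hqx
    have := le_csSup hbd key
    linarith

/-- The unique real number `r` with `a + M = r + M`. -/
def value (M : Yosida A) (a : A) : ℝ := (M.exists_real a).choose

theorem sub_value_mem (M : Yosida A) (a : A) : a - algebraMap ℝ A (M.value a) ∈ M.ideal :=
  (M.exists_real a).choose_spec

theorem value_eq {M : Yosida A} {a : A} {r : ℝ} (h : a - algebraMap ℝ A r ∈ M.ideal) :
    M.value a = r := by
  have := M.ideal.sub_mem h (M.sub_value_mem a)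
  rw [sub_sub_sub_cancel_left, ← map_sub, algebraMap_mem] at this
  linarith

/-- The morphism `A → ℝ` with kernel `M`. -/
def toHom (M : Yosida A) : Hom A ℝ where
  toFun := M.value
  map_one' := value_eq (by simp)
  map_zero' := value_eq (by simp)
  map_mul' a b := value_eq (by
    have h1 := M.ideal.mul_mem_right b (M.sub_value_mem a)
    have h2 := M.ideal.mul_mem_left (algebraMap ℝ A (M.value a)) (M.sub_value_mem b)
    have := M.ideal.add_mem h1 h2
    rw [map_mul]
    convert this using 1
    ring)
  map_add' a b := value_eq (by
    have := M.ideal.add_mem (M.sub_value_mem a) (M.sub_value_mem b)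
    rw [map_add]
    convert this using 1
    ring)
  commutes' r := value_eq (by simp)
  map_sup' a b := value_eq (by
    rw [algebraMap_sup]
    exact M.toLIdeal.sup_sub_sup_mem (M.sub_value_mem a) (M.sub_value_mem b))
  map_inf' a b := value_eq (by
    rw [algebraMap_inf]
    exact M.toLIdeal.inf_sub_inf_mem (M.sub_value_mem a) (M.sub_value_mem b))

theorem toHom_apply (M : Yosida A) (a : A) : M.toHom a = M.value a := rfl

theorem mem_iff (M : Yosida A) {a : A} : a ∈ M.ideal ↔ M.value a = 0 := by
  refine ⟨fun h => value_eq (by simpa using h), fun h => ?_⟩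
  simpa [h] using M.sub_value_mem a

/-- The point of the Yosida space given by the kernel of a morphism to `ℝ`. -/
def ofHom (f : Hom A ℝ) : Yosida A :=
  ofReal f.ker (fun h => one_ne_zero ((map_one f).symm.trans h))
    fun a => ⟨f a, by rw [Hom.mem_ker, map_sub, f.map_algebraMap]; exact sub_self _⟩

theorem value_ofHom (f : Hom A ℝ) (a : A) : (ofHom f).value a = f a :=
  value_eq (Eq.trans (map_sub f _ _) (by rw [f.map_algebraMap]; exact sub_self _))

end Points

section Topology

variable {A : Type*} [CommRing A] [Lattice A]

/-- The set `Z_ℓ(I)` of maximal `ℓ`-ideals that contain the `ℓ`-ideal `I`. -/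
def Z (I : LIdeal A) : Set (Yosida A) := {M | I.ideal ≤ M.ideal}

theorem mem_Z_gen {S : Set A} {M : Yosida A} : M ∈ Z (LIdeal.gen S) ↔ S ⊆ M.ideal :=
  ⟨fun h _ ha => h (LIdeal.mem_least.2 fun _ _ hS => hS ha),
    fun h _ ha => LIdeal.mem_least.1 ha M.toLIdeal trivial h⟩

variable [Algebra ℝ A] [IsBal A]

/-- The closed sets of the Yosida space are the sets `Z_ℓ(I)`. -/
instance : TopologicalSpace (Yosida A) := TopologicalSpace.ofClosed (Set.range Z)
  ⟨LIdeal.gen Set.univ, Set.eq_empty_of_forall_notMem fun M hM =>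
    M.one_notMem (mem_Z_gen.1 hM (Set.mem_univ 1))⟩
  (fun T hT => ⟨LIdeal.gen {a | ∃ I : LIdeal A, Z I ∈ T ∧ a ∈ I.ideal}, by
    ext M
    rw [mem_Z_gen, Set.mem_sInter]
    constructor
    · intro h t ht
      obtain ⟨I, rfl⟩ := hT ht
      exact fun a ha => h ⟨I, ht, ha⟩
    · rintro h a ⟨I, hI, ha⟩
      exact h _ hI ha⟩)
  (by
    rintro _ ⟨I, rfl⟩ _ ⟨J, rfl⟩
    refine ⟨LIdeal.gen {a | a ∈ I.ideal ∧ a ∈ J.ideal}, ?_⟩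
    ext M
    rw [mem_Z_gen, Set.mem_union]
    constructor
    · intro h
      by_contra! hcon
      obtain ⟨a, ha, haM⟩ := Set.not_subset.1 hcon.1
      obtain ⟨b, hb, hbM⟩ := Set.not_subset.1 hcon.2
      have hab : |a| ⊓ |b| ∈ M.ideal := by
        have h0 : (0 : A) ≤ |a| ⊓ |b| := le_inf (abs_nonneg a) (abs_nonneg b)
        refine h ⟨I.solid _ a ?_ ha, J.solid _ b ?_ hb⟩
        · rw [abs_of_nonneg h0]; exact inf_le_left
        · rw [abs_of_nonneg h0]; exact inf_le_right
      have h1 : |M.value a| ⊓ |M.value b| = 0 := by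
        have := M.mem_iff.1 hab
        rwa [← toHom_apply, map_inf, Hom.map_abs, Hom.map_abs] at this
      have ha0 : 0 < |M.value a| := abs_pos.2 fun h0 => haM (M.mem_iff.2 h0)
      have hb0 : 0 < |M.value b| := abs_pos.2 fun h0 => hbM (M.mem_iff.2 h0)
      exact (lt_inf_iff.2 ⟨ha0, hb0⟩).ne' h1
    · rintro (h | h) a ⟨ha, hb⟩
      exacts [h ha, h hb])

theorem isClosed_iff {t : Set (Yosida A)} : IsClosed t ↔ ∃ I : LIdeal A, Z I = t := by
  rw [← isOpen_compl_iff]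
  change tᶜᶜ ∈ Set.range Z ↔ _
  rw [compl_compl]
  rfl

theorem isClosed_subset (S : Set A) : IsClosed {M : Yosida A | S ⊆ M.ideal} :=
  isClosed_iff.2 ⟨LIdeal.gen S, Set.ext fun _ => mem_Z_gen⟩

theorem value_le_iff {M : Yosida A} {a : A} {r : ℝ} :
    M.value a ≤ r ↔ (a - algebraMap ℝ A r) ⊔ 0 ∈ M.ideal := by
  rw [mem_iff, ← toHom_apply, ← toHom_apply, map_sup, map_sub, map_zero, Hom.map_algebraMap,
    sup_eq_right, sub_nonpos]
  rfl

theorem le_value_iff {M : Yosida A} {a : A} {r : ℝ} :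
    r ≤ M.value a ↔ (algebraMap ℝ A r - a) ⊔ 0 ∈ M.ideal := by
  rw [mem_iff, ← toHom_apply, ← toHom_apply, map_sup, map_sub, map_zero, Hom.map_algebraMap,
    sup_eq_right, sub_nonpos]
  rfl

theorem continuous_value (a : A) : Continuous fun M : Yosida A => M.value a := by
  rw [OrderTopology.continuous_iff]
  refine fun r => ⟨?_, ?_⟩
  · rw [← isClosed_compl_iff]
    convert isClosed_subset {(a - algebraMap ℝ A r) ⊔ 0} using 1
    ext M
    simp [value_le_iff]
  · rw [← isClosed_compl_iff]
    convert isClosed_subset {(algebraMap ℝ A r - a) ⊔ 0} using 1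
    ext M
    simp [le_value_iff]

instance : T2Space (Yosida A) :=
  T2Space.of_injective_continuous (f := fun (M : Yosida A) (a : A) => M.value a)
    (fun M N h => ext' fun a => by
      rw [mem_iff, mem_iff]; exact iff_of_eq (congrArg (· = 0) (congrFun h a)))
    (continuous_pi continuous_value)

theorem abs_value_le (M : Yosida A) (a : A) : |M.value a| ≤ norm a :=
  M.toHom.abs_map_le (abs_le_norm a)

/-- The functions on `A` that are morphisms to `ℝ`. -/
def homSet (A : Type*) [CommRing A] [Lattice A] [Algebra ℝ A] : Set (A → ℝ) :=
  {p | p 1 = 1 ∧ (∀ a b, p (a + b) = p a + p b) ∧ (∀ a b, p (a * b) = p a * p b) ∧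
    (∀ r, p (algebraMap ℝ A r) = r) ∧ (∀ a b, p (a ⊔ b) = p a ⊔ p b) ∧
    (∀ a b, p (a ⊓ b) = p a ⊓ p b)}

/-- A function in `homSet A` as a morphism. -/
def homSet.toHom (p : homSet A) : Hom A ℝ where
  toFun := p.1
  map_one' := p.2.1
  map_zero' := by simpa using p.2.2.1 0 0
  map_add' := p.2.2.1
  map_mul' := p.2.2.2.1
  commutes' := p.2.2.2.2.1
  map_sup' := p.2.2.2.2.2.1
  map_inf' := p.2.2.2.2.2.2

theorem isCompact_homSet : IsCompact (homSet A) := by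
  refine (isCompact_univ_pi fun a : A => isCompact_Icc (a := -norm a) (b := norm a)).of_isClosed_subset
    ?_ fun p hp a _ => ?_
  · have c : ∀ a : A, Continuous fun p : A → ℝ => p a := continuous_apply
    simp only [homSet, Set.ofPred_and, Set.ofPred_forall]
    refine (isClosed_eq (c _) continuous_const).inter (.inter ?_ (.inter ?_ (.inter ?_
      (.inter ?_ ?_))))
    · exact isClosed_iInter fun a => isClosed_iInter fun b => isClosed_eq (c _) ((c _).add (c _))
    · exact isClosed_iInter fun a => isClosed_iInter fun b => isClosed_eq (c _) ((c _).mul (c _))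
    · exact isClosed_iInter fun r => isClosed_eq (c _) continuous_const
    · exact isClosed_iInter fun a => isClosed_iInter fun b => isClosed_eq (c _) ((c _).sup (c _))
    · exact isClosed_iInter fun a => isClosed_iInter fun b => isClosed_eq (c _) ((c _).inf (c _))
  · exact abs_le.1 ((homSet.toHom ⟨p, hp⟩).abs_map_le (abs_le_norm a))

instance : CompactSpace (Yosida A) := by
  have : CompactSpace (homSet A) := isCompact_iff_compactSpace.1 isCompact_homSet
  have hc : Continuous fun p : homSet A => ofHom (homSet.toHom p) := by
    rw [continuous_iff_isClosed]
    intro t ht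
    obtain ⟨I, rfl⟩ := isClosed_iff.1 ht
    have : (fun p : homSet A => ofHom (homSet.toHom p)) ⁻¹' Z I =
        ⋂ a ∈ I.ideal, {p : homSet A | p.1 a = 0} := by
      ext p
      simp only [Set.mem_iInter]
      rfl
    rw [this]
    exact isClosed_biInter fun a _ =>
      isClosed_eq ((continuous_apply a).comp continuous_subtype_val) continuous_const
  have hs : Function.Surjective fun p : homSet A => ofHom (homSet.toHom p) := fun M =>
    ⟨⟨M.value, M.toHom.map_one', M.toHom.map_add', M.toHom.map_mul', M.toHom.commutes',
      M.toHom.map_sup', M.toHom.map_inf'⟩, ext' fun a => M.mem_iff.symm⟩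
  exact ⟨hs.range_eq ▸ isCompact_range hc⟩

/-- The inverse image of a maximal `ℓ`-ideal under a morphism. -/
def comap {B : Type*} [CommRing B] [Lattice B] [Algebra ℝ B] [IsBal B] (f : Hom A B)
    (M : Yosida B) : Yosida A :=
  ofReal
    { ideal := Ideal.comap f M.ideal
      solid := fun a b hab hb => M.toLIdeal.solid (f a) (f b)
        (by rw [← f.map_abs, ← f.map_abs]; exact f.map_mono hab) hb }
    (fun h => M.one_notMem (map_one f ▸ h))
    (fun a => ⟨M.value (f a), by
      change f (a - _) ∈ M.ideal
      rw [map_sub, f.map_algebraMap]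
      exact M.sub_value_mem _⟩)

theorem value_comap {B : Type*} [CommRing B] [Lattice B] [Algebra ℝ B] [IsBal B] (f : Hom A B)
    (M : Yosida B) (a : A) : (comap f M).value a = M.value (f a) :=
  value_eq (by
    change f (a - _) ∈ M.ideal
    rw [map_sub, f.map_algebraMap]
    exact M.sub_value_mem _)

theorem continuous_comap {B : Type*} [CommRing B] [Lattice B] [Algebra ℝ B] [IsBal B]
    (f : Hom A B) : Continuous (comap f) := by
  rw [continuous_iff_isClosed]
  intro t ht
  obtain ⟨I, rfl⟩ := isClosed_iff.1 ht
  convert isClosed_subset (f '' (I.ideal : Set A)) using 1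
  ext M
  rw [Set.mem_ofPred_eq, Set.image_subset_iff]
  rfl

end Topology

end Yosida

/-- The functor `Y : baℓᵒᵖ ⥤ KHaus`. -/
def Y : BAL.{u}ᵒᵖ ⥤ CompHaus.{u} where
  obj A := CompHaus.of (Yosida A.unop)
  map f := CompHausLike.ofHom _ ⟨Yosida.comap (BAL.hom f.unop), Yosida.continuous_comap _⟩
  map_id _ := rfl
  map_comp _ _ := rfl

/-! ### The functor `C` -/

instance (X : Type*) [TopologicalSpace X] [CompactSpace X] : IsBal C(X, ℝ) where
  add_right a b h c := fun x => by simpa using h x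
  mul_nonneg a b ha hb := fun x => mul_nonneg (ha x) (hb x)
  smul_nonneg r a hr ha := fun x => mul_nonneg hr (ha x)
  bounded a := by
    obtain ⟨n, hn⟩ := exists_nat_ge ‖a‖
    exact ⟨n, fun x => by
      simpa using (le_abs_self _).trans ((a.norm_coe_le_norm x).trans hn)⟩
  archimedean a b h := fun x => IsBal.archimedean (a x) (b x) fun n => h n x

/-- Composition with a continuous map, as a morphism of `ℓ`-algebras. -/
def precomp {X Z : Type*} [TopologicalSpace X] [TopologicalSpace Z] (φ : C(X, Z)) :
    Hom C(Z, ℝ) C(X, ℝ) where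
  toFun f := f.comp φ
  map_one' := rfl
  map_zero' := rfl
  map_mul' _ _ := rfl
  map_add' _ _ := rfl
  commutes' _ := rfl
  map_sup' _ _ := rfl
  map_inf' _ _ := rfl

/-- The functor `C : KHausᵒᵖ ⥤ baℓ`. -/
def C : CompHaus.{u}ᵒᵖ ⥤ BAL.{u} where
  obj X := { carrier := C(X.unop, ℝ) }
  map φ := precomp φ.unop.hom.hom
  map_id _ := rfl
  map_comp _ _ := rfl

/-- Evaluation at a point. -/
def evalAt {X : Type*} [TopologicalSpace X] (x : X) : Hom C(X, ℝ) ℝ where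
  toFun f := f x
  map_one' := rfl
  map_zero' := rfl
  map_mul' _ _ := rfl
  map_add' _ _ := rfl
  commutes' _ := rfl
  map_sup' _ _ := rfl
  map_inf' _ _ := rfl

/-- The point `{f | f x = 0}` of the Yosida space of `C(X)`. -/
def evalPoint {X : Type*} [TopologicalSpace X] [CompactSpace X] (x : X) : Yosida C(X, ℝ) :=
  Yosida.ofHom (evalAt x)

theorem mem_evalPoint {X : Type*} [TopologicalSpace X] [CompactSpace X] {x : X} {f : C(X, ℝ)} :
    f ∈ (evalPoint x).ideal ↔ f x = 0 := Iff.rfl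

theorem continuous_evalPoint {X : Type*} [TopologicalSpace X] [CompactSpace X] :
    Continuous (evalPoint : X → Yosida C(X, ℝ)) := by
  rw [continuous_iff_isClosed]
  intro t ht
  obtain ⟨I, rfl⟩ := Yosida.isClosed_iff.1 ht
  have : (evalPoint : X → Yosida C(X, ℝ)) ⁻¹' Yosida.Z I = ⋂ f ∈ I.ideal, {x | f x = 0} := by
    ext x
    simp only [Set.mem_iInter]
    rfl
  rw [this]
  exact isClosed_biInter fun f _ => isClosed_eq f.continuous continuous_const

/-- The map `ε_X : X → Y_{C(X)}`, `x ↦ {f | f x = 0}`. -/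
def ε (X : CompHaus.{u}) : X ⟶ Y.obj (op (C.obj (op X))) :=
  CompHausLike.ofHom _ ⟨evalPoint, continuous_evalPoint⟩

/-- The map `ζ_A : A → C(Y_A)`; `ζ_A(a)(M)` is the real number `r` with `a + M = r + M`. -/
def ζHom (A : Type*) [CommRing A] [Lattice A] [Algebra ℝ A] [IsBal A] : Hom A C(Yosida A, ℝ) where
  toFun a := ⟨fun M => M.value a, Yosida.continuous_value a⟩
  map_one' := ContinuousMap.ext fun M => map_one M.toHom
  map_zero' := ContinuousMap.ext fun M => map_zero M.toHom
  map_mul' a b := ContinuousMap.ext fun M => map_mul M.toHom a b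
  map_add' a b := ContinuousMap.ext fun M => map_add M.toHom a b
  commutes' r := ContinuousMap.ext fun M => M.toHom.map_algebraMap r
  map_sup' a b := ContinuousMap.ext fun M => map_sup M.toHom a b
  map_inf' a b := ContinuousMap.ext fun M => map_inf M.toHom a b

/-- The map `ζ_A` as a morphism of `baℓ`. -/
def ζ (A : BAL.{u}) : A ⟶ C.obj (op (Y.obj (op A))) := ζHom A

theorem ε_naturality {X X' : CompHaus.{u}} (φ : X ⟶ X') :
    φ ≫ ε X' = ε X ≫ Y.map (C.map φ.op).op := rfl

theorem ζ_naturality {A A' : BAL.{u}} (γ : A ⟶ A') :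
    γ ≫ ζ A' = ζ A ≫ C.map (Y.map γ.op).op :=
  Hom.ext' (A := A) fun a => ContinuousMap.ext fun M => (Yosida.value_comap (BAL.hom γ) M a).symm

/-! ### The Vietoris endofunctor -/

/-- The Vietoris endofunctor. The closed subsets of a compact Hausdorff space, the empty set
included, are its compact subsets; they carry the topology generated by the sets
`{F | F ⊆ U}` and `{F | F ∩ U ≠ ∅}` for open `U`. -/
def V : CompHaus.{u} ⥤ CompHaus.{u} where
  obj X := CompHaus.of (Compacts X)
  map φ := CompHausLike.ofHom _ ⟨Compacts.map φ φ.hom.hom.continuous,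
    φ.hom.hom.continuous.compacts_map⟩
  map_id X := ConcreteCategory.hom_ext _ _ fun (F : Compacts X) =>
    show Compacts.map id continuous_id F = F from Compacts.ext (Set.image_id (F : Set X))
  map_comp {X _ _} φ ψ := ConcreteCategory.hom_ext _ _ fun (F : Compacts X) =>
    show Compacts.map (ψ ∘ φ) (ψ.hom.hom.continuous.comp φ.hom.hom.continuous) F
        = Compacts.map ψ ψ.hom.hom.continuous (Compacts.map φ φ.hom.hom.continuous F) from
      Compacts.ext (Set.image_comp ψ φ (F : Set X))

section Inf

variable {X : Type*} [TopologicalSpace X]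

open Classical in
/-- The function that sends a nonempty compact set `F` to `inf f(F)` and `∅` to `1`. -/
def infFun (f : C(X, ℝ)) (F : Compacts X) : ℝ :=
  if F = ⊥ then 1 else sInf (f '' F)

theorem infFun_bot (f : C(X, ℝ)) : infFun f ⊥ = 1 := if_pos rfl

theorem nonempty_of_ne_bot {F : Compacts X} (hF : F ≠ ⊥) : (F : Set X).Nonempty := by
  by_contra h
  exact hF (Compacts.ext (Set.not_nonempty_iff_eq_empty.1 h))

theorem isLeast_infFun (f : C(X, ℝ)) {F : Compacts X} (hF : F ≠ ⊥) :
    IsLeast (f '' F) (infFun f F) := by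
  rw [infFun, if_neg hF]
  exact (F.isCompact.image f.continuous).isLeast_sInf ((nonempty_of_ne_bot hF).image f)

theorem infFun_eq {f : C(X, ℝ)} {F : Compacts X} (hF : F ≠ ⊥) {m : ℝ}
    (hm : IsLeast (f '' F) m) : infFun f F = m := (isLeast_infFun f hF).unique hm

theorem continuous_infFun (f : C(X, ℝ)) : Continuous (infFun f) := by
  have hbot : IsClopen {(⊥ : Compacts X)} := Compacts.isClopen_singleton_bot
  rw [OrderTopology.continuous_iff]
  refine fun r => ⟨?_, ?_⟩
  · have h1 := Compacts.isOpen_subsets_of_isOpen ((isOpen_Ioi (a := r)).preimage f.continuous)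
    have : infFun f ⁻¹' Set.Ioi r = {F : Compacts X | (F : Set X) ⊆ f ⁻¹' Set.Ioi r} ∩
        ({F | r < 1} ∪ {⊥}ᶜ) := by
      ext F
      simp only [Set.mem_preimage, Set.mem_Ioi, Set.mem_inter_iff, Set.mem_ofPred_eq,
        Set.mem_union, Set.mem_compl_iff, Set.mem_singleton_iff]
      by_cases hF : F = ⊥
      · subst hF
        simp [infFun_bot]
      · obtain ⟨⟨x, hx, hxe⟩, hlb⟩ := isLeast_infFun f hF
        simp only [hF, not_false_eq_true, or_true, and_true]
        constructor
        · exact fun h y hy => h.trans_le (hlb ⟨y, hy, rfl⟩)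
        · intro h
          rw [← hxe]
          exact h hx
    rw [this]
    exact h1.inter (isOpen_const.union hbot.compl.isOpen)
  · have h1 := Compacts.isOpen_inter_nonempty_of_isOpen
      ((isOpen_Iio (a := r)).preimage f.continuous)
    have : infFun f ⁻¹' Set.Iio r = {F : Compacts X | ((F : Set X) ∩ f ⁻¹' Set.Iio r).Nonempty} ∪
        ({F | 1 < r} ∩ {⊥}) := by
      ext F
      simp only [Set.mem_preimage, Set.mem_Iio, Set.mem_inter_iff, Set.mem_ofPred_eq,
        Set.mem_union, Set.mem_singleton_iff]
      by_cases hF : F = ⊥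
      · subst hF
        simp [infFun_bot]
      · obtain ⟨⟨x, hx, hxe⟩, hlb⟩ := isLeast_infFun f hF
        simp only [hF, and_false, or_false]
        constructor
        · exact fun h => ⟨x, hx, by rw [← hxe] at h; exact h⟩
        · rintro ⟨y, hy, hyr⟩
          exact (hlb ⟨y, hy, rfl⟩).trans_lt hyr
    rw [this]
    exact h1.union (isOpen_const.inter hbot.isOpen)

theorem infFun_comp {f g : C(X, ℝ)} {φ : ℝ → ℝ} (hφ : Monotone φ) (h : ∀ x, g x = φ (f x))
    {F : Compacts X} (hF : F ≠ ⊥) : infFun g F = φ (infFun f F) := by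
  obtain ⟨⟨x, hx, hxe⟩, hlb⟩ := isLeast_infFun f hF
  refine infFun_eq hF ⟨⟨x, hx, by rw [h, hxe]⟩, ?_⟩
  rintro _ ⟨y, hy, rfl⟩
  rw [h]
  exact hφ (hlb ⟨y, hy, rfl⟩)

theorem infFun_inf (f g : C(X, ℝ)) (F : Compacts X) :
    infFun (f ⊓ g) F = infFun f F ⊓ infFun g F := by
  by_cases hF : F = ⊥
  · subst hF; simp [infFun_bot]
  obtain ⟨⟨x, hx, hxe⟩, hfl⟩ := isLeast_infFun f hF
  obtain ⟨⟨y, hy, hye⟩, hgl⟩ := isLeast_infFun g hF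
  refine infFun_eq hF ⟨?_, ?_⟩
  · rcases le_total (infFun f F) (infFun g F) with h | h
    · rw [inf_eq_left.2 h]
      refine ⟨x, hx, ?_⟩
      rw [ContinuousMap.inf_apply, hxe, inf_eq_left]
      exact h.trans (hgl ⟨x, hx, rfl⟩)
    · rw [inf_eq_right.2 h]
      refine ⟨y, hy, ?_⟩
      rw [ContinuousMap.inf_apply, hye, inf_eq_right]
      exact h.trans (hfl ⟨y, hy, rfl⟩)
  · rintro _ ⟨z, hz, rfl⟩
    exact inf_le_inf (hfl ⟨z, hz, rfl⟩) (hgl ⟨z, hz, rfl⟩)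

end Inf

/-! ### The morphism `η_A : H(A) → C(V(Y_A))` -/

section Box

variable (A : Type*) [CommRing A] [Lattice A] [Algebra ℝ A] [IsBal A]

/-- The map `g_A : A → C(V(Y_A))`: `g_A(a)(F)` is `inf ζ_A(a)(F)` for `F ≠ ∅` and `1` for
`F = ∅`. -/
def g (a : A) : C(Compacts (Yosida A), ℝ) := ⟨infFun (ζHom A a), continuous_infFun _⟩

theorem norm_g_le (a : A) : norm (g A a) ≤ weight a := by
  have key : ∀ F : Compacts (Yosida A), |infFun (ζHom A a) F| ≤ weight a := fun F => by
    by_cases hF : F = ⊥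
    · subst hF
      rw [infFun_bot, abs_one]
      exact le_max_right _ _
    · obtain ⟨⟨M, -, hM⟩, -⟩ := isLeast_infFun (ζHom A a) hF
      rw [← hM]
      exact (M.abs_value_le a).trans (le_max_left _ _)
  refine norm_le (weight a).2 (abs_le'.2 ⟨fun F => ?_, fun F => ?_⟩)
  · exact (le_abs_self _).trans (key F)
  · exact (neg_le_abs _).trans (key F)

theorem isBox_g : IsBox (g A) where
  inf a b := ContinuousMap.ext fun F => by
    change infFun (ζHom A (a ⊓ b)) F = infFun (ζHom A a) F ⊓ infFun (ζHom A b) F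
    rw [map_inf]; exact infFun_inf _ _ F
  const r := ContinuousMap.ext fun F => by
    change infFun (ζHom A (algebraMap ℝ A r)) F = r + (1 - r) * infFun (ζHom A 0) F
    by_cases hF : F = ⊥
    · subst hF; simp [infFun_bot]
    · rw [infFun_comp (f := ζHom A 0) (φ := fun _ => r) monotone_const _ hF,
        infFun_comp (f := ζHom A 0) (φ := fun _ => 0) monotone_const _ hF]
      · simp
      · exact fun M => map_zero M.toHom
      · exact fun M => M.toHom.map_algebraMap r
  pos a := ContinuousMap.ext fun F => by
    change infFun (ζHom A (a ⊔ 0)) F = infFun (ζHom A a) F ⊔ 0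
    by_cases hF : F = ⊥
    · subst hF; simp [infFun_bot]
    · refine infFun_comp (φ := fun t => t ⊔ 0) (fun s t h => sup_le_sup_right h 0) (fun M => ?_) hF
      exact (map_sup M.toHom a 0).trans (by rw [map_zero]; rfl)
  add a r := ContinuousMap.ext fun F => by
    change infFun (ζHom A (a + algebraMap ℝ A r)) F
      = infFun (ζHom A a) F + infFun (ζHom A (algebraMap ℝ A r)) F - infFun (ζHom A 0) F
    by_cases hF : F = ⊥
    · subst hF; simp [infFun_bot]
    · rw [infFun_comp (f := ζHom A 0) (g := ζHom A (algebraMap ℝ A r)) (φ := fun _ => r)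
          monotone_const _ hF,
        infFun_comp (f := ζHom A 0) (g := ζHom A 0) (φ := fun _ => 0) monotone_const _ hF, sub_zero]
      · refine infFun_comp (φ := fun t => t + r) (fun s t h => by simpa using h) (fun M => ?_) hF
        exact (map_add M.toHom a _).trans (by rw [Hom.map_algebraMap]; rfl)
      · exact fun M => map_zero M.toHom
      · exact fun M => M.toHom.map_algebraMap r
  smul r hr a := ContinuousMap.ext fun F => by
    change infFun (ζHom A (r • a)) F = infFun (ζHom A (algebraMap ℝ A r)) F * infFun (ζHom A a) F
    by_cases hF : F = ⊥
    · subst hF; simp [infFun_bot]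
    · rw [infFun_comp (f := ζHom A 0) (g := ζHom A (algebraMap ℝ A r)) (φ := fun _ => r)
          monotone_const _ hF]
      · refine infFun_comp (φ := fun t => r * t) (fun s t h => mul_le_mul_of_nonneg_left h hr)
          (fun M => ?_) hF
        exact map_smul M.toHom r a
      · exact fun M => M.toHom.map_algebraMap r

end Box

/-- The unique morphism `η_A : H(A) → C(V(Y_A))` with `η_A(□_a) = g_A(a)`. -/
def η (A : BAL.{u}) : H.obj A ⟶ C.obj (op (V.obj (Y.obj (op A)))) :=
  HLift (B := C.obj (op (V.obj (Y.obj (op A))))) (g A) (norm_g_le A) ((isBox_g A).lift_eq_zero _)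

theorem η_box {A : BAL.{u}} (a : A) : η A (box a) = g A a := rfl

theorem infFun_map {X Z : Type*} [TopologicalSpace X] [TopologicalSpace Z] (φ : C(X, Z))
    (f : C(Z, ℝ)) (F : Compacts X) :
    infFun f (Compacts.map φ φ.continuous F) = infFun (f.comp φ) F := by
  have h : Compacts.map φ φ.continuous F = ⊥ ↔ F = ⊥ := by
    rw [← SetLike.coe_set_eq, ← SetLike.coe_set_eq (p := F)]
    simp
  unfold infFun
  by_cases hF : F = ⊥
  · rw [if_pos hF, if_pos (h.2 hF)]
  · rw [if_neg hF, if_neg (mt h.1 hF)]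
    simp [Set.image_image]

theorem η_naturality {A A' : BAL.{u}} (γ : A ⟶ A') :
    H.map γ ≫ η A' = η A ≫ C.map (V.map (Y.map γ.op)).op := by
  refine H_hom_ext fun a => ?_
  refine ContinuousMap.ext fun (F : Compacts (Yosida A')) => ?_
  have h : ζHom A' (BAL.hom γ a)
      = (ζHom A a).comp ⟨Yosida.comap (BAL.hom γ), Yosida.continuous_comap _⟩ :=
    ContinuousMap.ext fun M => (Yosida.value_comap (BAL.hom γ) M a).symm
  exact (congrArg (infFun · F) h).trans (infFun_map _ (ζHom A a) F).symm

/-! ### The functors between algebras and coalgebras -/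

/-- The structure map `F_α = ε⁻¹ ∘ Y(η_A)⁻¹ ∘ Y(α) : Y_A → V(Y_A)`. It is defined once the maps
`ε_X` and `Y(η_A)` are known to be homeomorphisms. -/
def FStr (hε : ∀ X : CompHaus.{u}, IsIso (ε X)) (hη : ∀ A : BAL.{u}, IsIso (Y.map (η A).op))
    {A : BAL.{u}} (α : H.obj A ⟶ A) : Y.obj (op A) ⟶ V.obj (Y.obj (op A)) :=
  have := hε
  have := hη
  Y.map α.op ≫ inv (Y.map (η A).op) ≫ inv (ε (V.obj (Y.obj (op A))))

theorem FStr_naturality (hε : ∀ X : CompHaus.{u}, IsIso (ε X))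
    (hη : ∀ A : BAL.{u}, IsIso (Y.map (η A).op)) {A A' : BAL.{u}} {α : H.obj A ⟶ A}
    {α' : H.obj A' ⟶ A'} (γ : A ⟶ A') (hγ : H.map γ ≫ α' = α ≫ γ) :
    FStr hε hη α' ≫ V.map (Y.map γ.op) = Y.map γ.op ≫ FStr hε hη α := by
  have := hε
  have := hη
  have h1 := ε_naturality (V.map (Y.map γ.op))
  have h2 : Y.map (C.map (V.map (Y.map γ.op)).op).op ≫ Y.map (η A).op
      = Y.map (η A').op ≫ Y.map (H.map γ).op := by
    rw [← Functor.map_comp, ← op_comp, ← η_naturality, op_comp, Functor.map_comp]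
  have h3 : Y.map α'.op ≫ Y.map (H.map γ).op = Y.map γ.op ≫ Y.map α.op := by
    rw [← Functor.map_comp, ← op_comp, hγ, op_comp, Functor.map_comp]
  have h4 : inv (ε (V.obj (Y.obj (op A')))) ≫ V.map (Y.map γ.op)
      = Y.map (C.map (V.map (Y.map γ.op)).op).op ≫ inv (ε (V.obj (Y.obj (op A)))) := by
    rw [IsIso.inv_comp_eq, ← Category.assoc, IsIso.eq_comp_inv, h1]
  have h5 : inv (Y.map (η A').op) ≫ Y.map (C.map (V.map (Y.map γ.op)).op).op
      = Y.map (H.map γ).op ≫ inv (Y.map (η A).op) := by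
    rw [IsIso.inv_comp_eq, ← Category.assoc, IsIso.eq_comp_inv, h2]
  unfold FStr
  rw [Category.assoc, Category.assoc, h4, reassoc_of% h5, reassoc_of% h3]

/-- The contravariant functor `F : Alg(H) → Coalg(V)`, `(A, α) ↦ (Y_A, F_α)`, `γ ↦ Y(γ)`. -/
def F (hε : ∀ X : CompHaus.{u}, IsIso (ε X)) (hη : ∀ A : BAL.{u}, IsIso (Y.map (η A).op)) :
    (Endofunctor.Algebra H.{u})ᵒᵖ ⥤ Endofunctor.Coalgebra V.{u} where
  obj A := { V := Y.obj (op A.unop.a), str := FStr hε hη A.unop.str }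
  map γ := { f := Y.map γ.unop.f.op, h := FStr_naturality hε hη γ.unop.f γ.unop.h }
  map_id _ := rfl
  map_comp _ _ := rfl

/-- The structure map `G_σ = C(σ) ∘ C(V(ε_X)) ∘ η_{C(X)} : H(C(X)) → C(X)`. -/
def GStr {X : CompHaus.{u}} (σ : X ⟶ V.obj X) : H.obj (C.obj (op X)) ⟶ C.obj (op X) :=
  η (C.obj (op X)) ≫ C.map (V.map (ε X)).op ≫ C.map σ.op

theorem GStr_naturality {X X' : CompHaus.{u}} {σ : X ⟶ V.obj X} {σ' : X' ⟶ V.obj X'} (φ : X ⟶ X')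
    (hφ : σ ≫ V.map φ = φ ≫ σ') :
    H.map (C.map φ.op) ≫ GStr σ = GStr σ' ≫ C.map φ.op := by
  have h1 := η_naturality (C.map φ.op)
  have h2 : C.map (V.map (Y.map (C.map φ.op).op)).op ≫ C.map (V.map (ε X)).op
      = C.map (V.map (ε X')).op ≫ C.map (V.map φ).op := by
    rw [← Functor.map_comp, ← op_comp, ← Functor.map_comp, ← ε_naturality, Functor.map_comp,
      op_comp, Functor.map_comp]
  have h3 : C.map (V.map φ).op ≫ C.map σ.op = C.map σ'.op ≫ C.map φ.op := by
    rw [← Functor.map_comp, ← op_comp, hφ, op_comp, Functor.map_comp]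
  unfold GStr
  rw [reassoc_of% h1, reassoc_of% h2, h3, Category.assoc, Category.assoc]

/-- The contravariant functor `G : Coalg(V) → Alg(H)`, `(X, σ) ↦ (C(X), G_σ)`, `φ ↦ C(φ)`. -/
def G : (Endofunctor.Coalgebra V.{u})ᵒᵖ ⥤ Endofunctor.Algebra H.{u} where
  obj X := { a := C.obj (op X.unop.V), str := GStr X.unop.str }
  map φ := { f := C.map φ.unop.f.op, h := GStr_naturality φ.unop.f φ.unop.h }
  map_id _ := rfl
  map_comp _ _ := rfl

end Bal

end

namespace Bal

/-! Gelfand duality provides a dual adjunction between bounded archimedean ℓ-algebras and compact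
Hausdorff spaces with units `ζ` and `ε`. It lifts to algebras and coalgebras because `η` matches `H`
with `V` and becomes invertible after `Y`. So two facts about spaces carry the theorem, and the rest
is diagram chasing.

`ε X` is invertible: Urysohn functions separate points. If a maximal ℓ-ideal `M` of `C(X)` were not
the ideal of a point, each point would have a member of `M` that does not vanish there; by
compactness a finite sum of squares in `M` would vanish nowhere and be a unit. A continuous
bijection of compact Hausdorff spaces is a homeomorphism.

`Y(η_A)` is invertible: since `ε` is, it suffices that `ηPoint`, the composite of `ε` with `Y(η_A)`,
is bijective from closed sets `F` of `Y_A` to points of `Y_{H(A)}`. Such a point is a morphism to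
`ℝ`, determined by its values `q a` at `□_a`, and `q` satisfies the box relations. So the claim is
that every such functional `q` is the infimum over exactly one closed set, with the value `1` for
the empty set.

The relations force `q 0` to be `0` or `1`. If it is `1`, then `q` is constantly `1` and `F = ∅`. If
it is `0`, then `q` is monotone, preserves meets, commutes with adding constants and with joins with
constants. Let `F` be the set of all `M` at which every `b` with `q b ≥ 0` is nonnegative. Shifting
`a` by `q a` shows `q a ≤ a(M)` on `F` (`IsBox.exists_compacts`). That the bound is attained means
that the elements `(a - q a) ⊔ -b ⊔ 0` with `0 ≤ q b` lie in a common maximal ℓ-ideal. They are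
directed, so it is enough that no multiple of one of them exceeds `1`, which is `IsBox.not_one_le`,
the heart of the proof. Uniqueness of `F` is `subset_of_g_eq`. -/

/-! ### The points of the Yosida space of `C(X)` -/

theorem evalPoint_injective {X : Type*} [TopologicalSpace X] [CompactSpace X] [T2Space X] :
    Function.Injective (evalPoint : X → Yosida C(X, ℝ)) := by
  intro x y h
  by_contra hxy
  obtain ⟨f, hf, hg, -⟩ := exists_continuous_zero_one_of_isClosed (isClosed_singleton (x := x))
    (isClosed_singleton (x := y)) (Set.disjoint_singleton.2 hxy)
  have h1 : f ∈ (evalPoint x).ideal := mem_evalPoint.2 (hf rfl)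
  rw [h, mem_evalPoint, hg rfl] at h1
  exact one_ne_zero h1

theorem Yosida.eq_of_le {A : Type*} [CommRing A] [Lattice A] {M N : Yosida A}
    (h : M.ideal ≤ N.ideal) : M = N :=
  Yosida.ext' fun a => by
    rw [Yosida.ideal, Yosida.ideal, M.maximal N.toLIdeal N.ne_top h]

/-- A maximal ℓ-ideal without a common zero would contain a nowhere vanishing function, which is a
unit. -/
theorem evalPoint_surjective {X : Type*} [TopologicalSpace X] [CompactSpace X] :
    Function.Surjective (evalPoint : X → Yosida C(X, ℝ)) := by
  intro M
  by_contra! hcon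
  have hx : ∀ x : X, ∃ f ∈ M.ideal, f x ≠ 0 := fun x => by
    by_contra! h
    -- If all of `M` vanished at `x`, then `M` would lie in the ideal of `x`, and maximality would
    -- make them equal.
    exact hcon x (Yosida.eq_of_le (M := M) fun f hf => mem_evalPoint.2 (h f hf)).symm
  choose f hf hfx using hx
  obtain ⟨t, ht⟩ := CompactSpace.elim_nhds_subcover (fun x => {y | f x y ≠ 0})
    fun x => (isOpen_ne_fun (f x).continuous continuous_const).mem_nhds (hfx x)
  -- Squares prevent cancellation: the sum is positive wherever one of the finitely many functions
  -- is nonzero.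
  set s : C(X, ℝ) := ∑ x ∈ t, f x * f x with hs
  have hsM : s ∈ M.ideal := M.ideal.sum_mem fun x _ => M.ideal.mul_mem_left _ (hf x)
  have hs0 : ∀ y, s y ≠ 0 := fun y => by
    have hy : y ∈ ⋃ x ∈ t, {y | f x y ≠ 0} := ht ▸ Set.mem_univ y
    simp only [Set.mem_iUnion] at hy
    obtain ⟨x, hxt, hxy⟩ := hy
    rw [hs, ContinuousMap.sum_apply]
    refine (Finset.sum_pos' (fun z _ => mul_self_nonneg (f z y)) ⟨x, hxt, ?_⟩).ne'
    exact mul_self_pos.2 hxy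
  refine M.one_notMem ?_
  have := M.ideal.mul_mem_left (⟨fun y => (s y)⁻¹, s.continuous.inv₀ hs0⟩ : C(X, ℝ)) hsM
  convert this using 1
  ext y
  exact (inv_mul_cancel₀ (hs0 y)).symm

theorem isIso_ε (X : CompHaus.{u}) : IsIso (ε X) :=
  CompHausLike.isIso_of_bijective _ ⟨evalPoint_injective, evalPoint_surjective⟩

/-! ### Existence of maximal ℓ-ideals -/

section Maximal

variable {A : Type*} [CommRing A] [Lattice A]

/-- Every proper `ℓ`-ideal is contained in a maximal one. -/
theorem LIdeal.exists_le_yosida (I : LIdeal A) (hI : (1 : A) ∉ I.ideal) :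
    ∃ M : Yosida A, I.ideal ≤ M.ideal := by
  -- Properness is expressed as `1 ∉ J`, so that it passes, like solidity, to the union of a chain.
  obtain ⟨J, hIJ, ⟨hJs, hJ1⟩, hJ⟩ := zorn_le_nonempty₀
    {J : Ideal A | (∀ a b : A, |a| ≤ |b| → b ∈ J → a ∈ J) ∧ (1 : A) ∉ J} (fun c hc hch K hK => by
      have hmem : ∀ a, a ∈ sSup c ↔ ∃ L ∈ c, a ∈ L := fun a =>
        Submodule.mem_sSup_of_directed ⟨K, hK⟩ hch.directedOn
      refine ⟨sSup c, ⟨fun a b hab hb => ?_, fun h1 => ?_⟩, fun L hL => le_sSup hL⟩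
      · obtain ⟨L, hL, hbL⟩ := (hmem b).1 hb
        exact (hmem a).2 ⟨L, hL, (hc hL).1 a b hab hbL⟩
      · obtain ⟨L, hL, h1L⟩ := (hmem 1).1 h1
        exact (hc hL).2 h1L) I.ideal ⟨I.solid, hI⟩
  refine ⟨⟨⟨J, hJs⟩, fun h => hJ1 ((Ideal.eq_top_iff_one _).1 h), fun K hK hJK =>
    le_antisymm (hJ ⟨K.solid, fun h => hK ((Ideal.eq_top_iff_one _).2 h)⟩ hJK) hJK⟩, hIJ⟩

variable [Algebra ℝ A] [IsBal A]

/-- The `ℓ`-ideal of the elements bounded by multiples of members of a set of nonnegative elements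
that is directed upwards. -/
def LIdeal.ofDirected (S : Set A) (hne : S.Nonempty)
    (hdir : ∀ x ∈ S, ∀ y ∈ S, ∃ z ∈ S, x ≤ z ∧ y ≤ z) : LIdeal A where
  ideal :=
    { carrier := {y | ∃ x ∈ S, ∃ n : ℕ, |y| ≤ n • x}
      zero_mem' := by
        obtain ⟨x, hx⟩ := hne
        exact ⟨x, hx, 0, by simp⟩
      add_mem' := by
        rintro a b ⟨x, hx, n, h⟩ ⟨y, hy, m, k⟩
        obtain ⟨z, hz, hxz, hyz⟩ := hdir x hx y hy
        refine ⟨z, hz, n + m, (abs_add_le a b).trans ?_⟩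
        rw [add_smul]
        exact add_le_add (h.trans (nsmul_le_nsmul_right hxz n))
          (k.trans (nsmul_le_nsmul_right hyz m))
      smul_mem' := by
        rintro c y ⟨x, hx, n, h⟩
        obtain ⟨k, hk⟩ := IsBal.bounded |c|
        refine ⟨x, hx, k * n, ?_⟩
        calc |c * y| ≤ (k • (1 : A)) * (n • x) := abs_mul_le hk h
          _ = _ := by rw [smul_one_mul, mul_smul] }
  solid := by
    rintro a b hab ⟨x, hx, n, h⟩
    exact ⟨x, hx, n, hab.trans h⟩

/-- A directed set of nonnegative elements whose multiples do not exceed `1` is contained in a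
maximal `ℓ`-ideal. -/
theorem exists_yosida_of_directed (S : Set A) (hne : S.Nonempty) (hpos : ∀ x ∈ S, 0 ≤ x)
    (hdir : ∀ x ∈ S, ∀ y ∈ S, ∃ z ∈ S, x ≤ z ∧ y ≤ z) (h1 : ∀ x ∈ S, ∀ n : ℕ, ¬ 1 ≤ n • x) :
    ∃ M : Yosida A, S ⊆ M.ideal := by
  obtain ⟨M, hM⟩ := (LIdeal.ofDirected S hne hdir).exists_le_yosida (by
    rintro ⟨x, hx, n, h⟩
    exact h1 x hx n ((le_abs_self _).trans h))
  exact ⟨M, fun x hx => hM ⟨x, hx, 1, by rw [one_smul, abs_of_nonneg (hpos x hx)]⟩⟩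

end Maximal

/-! ### Functionals that satisfy the box relations are infima over closed sets -/

section Functional

variable {A : Type*} [CommRing A] [Lattice A] [Algebra ℝ A] {q : A → ℝ}

/-- The scalar relation with `r = 0` and `a = 0` makes `q 0` idempotent. The two values separate the
nonempty closed sets from the empty one. -/
theorem IsBox.map_zero_eq (hq : IsBox q) : q 0 = 0 ∨ q 0 = 1 := by
  have h := hq.smul 0 le_rfl 0
  rw [map_zero, smul_zero] at h
  rcases eq_or_ne (q 0) 0 with h0 | h0
  · exact Or.inl h0
  · exact Or.inr (mul_right_cancel₀ h0 (by rw [← h, one_mul]))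

/-- The scalar relation with `r = 0` reads `q 0 = q 0 * q a`. -/
theorem IsBox.eq_one (hq : IsBox q) (h0 : q 0 = 1) (a : A) : q a = 1 := by
  have h := hq.smul 0 le_rfl a
  rwa [map_zero, zero_smul, h0, one_mul, eq_comm] at h

theorem IsBox.monotone (hq : IsBox q) : Monotone q := fun a b h => by
  have := hq.inf a b
  rw [inf_eq_left.2 h] at this
  exact inf_eq_left.1 this.symm

theorem IsBox.map_algebraMap (hq : IsBox q) (h0 : q 0 = 0) (r : ℝ) :
    q (algebraMap ℝ A r) = r := by
  rw [hq.const, h0]; simp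

theorem IsBox.map_add_algebraMap (hq : IsBox q) (h0 : q 0 = 0) (a : A) (r : ℝ) :
    q (a + algebraMap ℝ A r) = q a + r := by
  rw [hq.add, hq.map_algebraMap h0, h0, sub_zero]

theorem IsBox.map_sub_algebraMap (hq : IsBox q) (h0 : q 0 = 0) (a : A) (r : ℝ) :
    q (a - algebraMap ℝ A r) = q a - r := by
  rw [sub_eq_add_neg, ← map_neg, hq.map_add_algebraMap h0, sub_eq_add_neg]

variable [IsBal A]

/-- Translation by `r` reduces this to the relation for positive parts. -/
theorem IsBox.map_sup_algebraMap (hq : IsBox q) (h0 : q 0 = 0) (a : A) (r : ℝ) :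
    q (a ⊔ algebraMap ℝ A r) = q a ⊔ r := by
  have e : a ⊔ algebraMap ℝ A r = ((a - algebraMap ℝ A r) ⊔ 0) + algebraMap ℝ A r := by
    rw [sup_add, sub_add_cancel, zero_add]
  rw [e, hq.map_add_algebraMap h0, hq.pos, hq.map_sub_algebraMap h0, ← max_add_add_right,
    sub_add_cancel, zero_add]

/-- A meet is at most the average of its two arguments, and here they add up to the constant `2s`.
-/
theorem neg_inf_add_le (b : A) (s : ℝ) :
    -b ⊓ (b + algebraMap ℝ A (s + s)) ≤ algebraMap ℝ A s := by
  set x := -b ⊓ (b + algebraMap ℝ A (s + s))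
  have h : x + x ≤ algebraMap ℝ A s + algebraMap ℝ A s := by
    calc x + x ≤ -b + (b + algebraMap ℝ A (s + s)) := add_le_add inf_le_left inf_le_right
      _ = _ := by rw [map_add]; abel
  refine sub_nonneg.1 (nonneg_of_add_self ?_)
  rw [sub_add_sub_comm]
  exact sub_nonneg.2 h

/-- Only finite meets and joins with constants are controlled by `q`, so the join with `-b` has to
be removed first. If a multiple of `x = a ⊔ -b ⊔ 0` exceeded `1`, then `x` would lie above a
positive constant. Meeting `x` with `b + 2s` keeps the value of `q` at least `2s`, but cuts the part
`-b` down to at most `s`. What is left lies below `a ⊔ s`, where `q` is only `s`. -/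
theorem IsBox.not_one_le (hq : IsBox q) (h0 : q 0 = 0) {a b : A} (ha : q a ≤ 0) (hb : 0 ≤ q b)
    (n : ℕ) : ¬ 1 ≤ n • (a ⊔ -b ⊔ 0) := by
  intro h
  -- With `n + 1` in place of `n` the inverse also makes sense for `n = 0`. Then `x ≥ 4s`, more than
  -- the `2s` needed below.
  set s : ℝ := ((n : ℝ) + 1)⁻¹ / 4 with hs
  have hs0 : 0 < s := by positivity
  set x := a ⊔ -b ⊔ 0 with hx
  have hx0 : 0 ≤ x := le_sup_right
  have h1 : algebraMap ℝ A (s * 4) ≤ x := by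
    have h2 : (1 : A) ≤ (n + 1) • x := h.trans (nsmul_le_nsmul_left hx0 (Nat.le_succ n))
    have h3 := IsBal.smul_nonneg ((n : ℝ) + 1)⁻¹ _ (by positivity) (sub_nonneg.2 h2)
    have h4 : ((n : ℝ) + 1)⁻¹ * ((n + 1 : ℕ) : ℝ) = 1 := by
      push_cast; exact inv_mul_cancel₀ (by positivity)
    rw [smul_sub, ← Nat.cast_smul_eq_nsmul ℝ, smul_smul, h4, one_smul, sub_nonneg,
      ← Algebra.algebraMap_eq_smul_one] at h3
    rwa [hs, div_mul_cancel₀ _ (by norm_num)]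
  set y := x ⊓ (b + algebraMap ℝ A (s + s)) with hy
  have hlow : s + s ≤ q y := by
    rw [hy, hq.inf, hq.map_add_algebraMap h0]
    refine le_inf ?_ (by linarith)
    have := hq.monotone h1
    rw [hq.map_algebraMap h0] at this
    linarith
  have hup : y ≤ a ⊔ algebraMap ℝ A s := by
    -- A lattice-ordered abelian group is distributive; the instance is named because the given
    -- lattice structure does not include distributivity.
    rw [hy, hx, @inf_sup_right A (AddCommGroup.toDistribLattice A),
      @inf_sup_right A (AddCommGroup.toDistribLattice A)]
    refine sup_le (sup_le (inf_le_left.trans le_sup_left) ?_) ?_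
    · exact (neg_inf_add_le b s).trans le_sup_right
    · refine inf_le_left.trans (le_trans ?_ le_sup_right)
      rw [← map_zero (algebraMap ℝ A)]
      exact algebraMap_mono hs0.le
  have := hq.monotone hup
  rw [hq.map_sup_algebraMap h0] at this
  have h5 : q a ⊔ s = s := sup_eq_right.2 (ha.trans hs0.le)
  linarith

/-- A functional that satisfies the relations of the elements `□_a` and vanishes at `0` is the
infimum over a nonempty closed set. -/
theorem IsBox.exists_compacts (hq : IsBox q) (h0 : q 0 = 0) :
    ∃ F : Compacts (Yosida A), F ≠ ⊥ ∧ ∀ a, infFun (ζHom A a) F = q a := by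
  -- The largest candidate: if `q` is the infimum over `F`, every `b` with `q b ≥ 0` is nonnegative
  -- on `F`. Written through the elements `-b ⊔ 0`, the set is visibly closed.
  let K : Set (Yosida A) := {M | ((fun b : A => -b ⊔ 0) '' {b | 0 ≤ q b}) ⊆ M.ideal}
  have hKmem : ∀ M : Yosida A, M ∈ K ↔ ∀ b, 0 ≤ q b → 0 ≤ M.value b := fun M => by
    change (_ : Set A) ⊆ M.ideal ↔ _
    rw [Set.image_subset_iff]
    refine forall₂_congr fun b _ => ?_
    rw [Yosida.le_value_iff, map_zero, zero_sub]
    rfl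
  have hex : ∀ a, ∃ M ∈ K, M.value a ≤ q a := fun a => by
    set a' := a - algebraMap ℝ A (q a) with ha'
    have hqa : q a' = 0 := by rw [ha', hq.map_sub_algebraMap h0, sub_self]
    -- One ideal has to encode both demands on `M`: it contains `a' ⊔ -b ⊔ 0` exactly when `a'` is
    -- at most `0` and `b` at least `0` at `M`. The family is directed because `q` preserves meets:
    -- `b ⊓ c` serves for `b` and `c`.
    obtain ⟨M, hM⟩ := exists_yosida_of_directed ((fun b : A => a' ⊔ -b ⊔ 0) '' {b | 0 ≤ q b})
      ⟨_, 0, h0.ge, rfl⟩ (by rintro _ ⟨b, -, rfl⟩; exact le_sup_right) (by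
        rintro _ ⟨b, hb, rfl⟩ _ ⟨c, hc, rfl⟩
        refine ⟨_, ⟨b ⊓ c, ?_, rfl⟩, ?_, ?_⟩
        · change 0 ≤ q (b ⊓ c)
          rw [hq.inf]
          exact le_inf hb hc
        · exact sup_le_sup_right (sup_le_sup_left (neg_le_neg inf_le_left) _) _
        · exact sup_le_sup_right (sup_le_sup_left (neg_le_neg inf_le_right) _) _)
      (by rintro _ ⟨b, hb, rfl⟩ n; exact hq.not_one_le h0 hqa.le hb n)
    have hv : ∀ b, 0 ≤ q b → M.value a' ≤ 0 ∧ 0 ≤ M.value b := fun b hb => by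
      have h1 := M.mem_iff.1 (hM ⟨b, hb, rfl⟩)
      rw [← Yosida.toHom_apply, map_sup, map_sup, map_zero, map_neg, sup_eq_right, sup_le_iff] at h1
      exact ⟨h1.1, neg_nonpos.1 h1.2⟩
    refine ⟨M, (hKmem M).2 fun b hb => (hv b hb).2, ?_⟩
    -- Any `b` with `q b ≥ 0` would do here; `b = 0` is available because `q 0 = 0`.
    have h1 := (hv 0 h0.ge).1
    rw [← Yosida.toHom_apply, ha', map_sub, Hom.map_algebraMap] at h1
    exact sub_nonpos.1 h1
  have hle : ∀ a, ∀ M ∈ K, q a ≤ M.value a := fun a M hM => by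
    have h1 := (hKmem M).1 hM (a - algebraMap ℝ A (q a))
      (by rw [hq.map_sub_algebraMap h0, sub_self])
    rw [← Yosida.toHom_apply, map_sub, Hom.map_algebraMap] at h1
    exact sub_nonneg.1 h1
  have hF : (⟨K, (Yosida.isClosed_subset _).isCompact⟩ : Compacts (Yosida A)) ≠ ⊥ := fun h => by
    -- The attainment statement for any single element already gives a point of `K`.
    obtain ⟨M, hM, -⟩ := hex 0
    have : M ∈ ((⊥ : Compacts (Yosida A)) : Set (Yosida A)) := h ▸ hM
    simp at this
  refine ⟨_, hF, fun a => infFun_eq hF ⟨?_, ?_⟩⟩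
  · obtain ⟨M, hM, hMa⟩ := hex a
    exact ⟨M, hM, le_antisymm hMa (hle a M hM)⟩
  · rintro _ ⟨M, hM, rfl⟩
    exact hle a M hM

/-- Closed sets are cut out by ℓ-ideals, so a point `M` of `F` outside `F'` is witnessed by some `c`
that vanishes on `F'` but not at `M`. The infimum of `-|c|` is then `0` over `F'` and negative over
`F`. -/
theorem subset_of_g_eq {F F' : Compacts (Yosida A)} (h : ∀ a, g A a F = g A a F') :
    (F : Set (Yosida A)) ⊆ F' := by
  intro M hM
  by_contra hM'
  have hF : F ≠ ⊥ := by rintro rfl; exact hM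
  have hz : ∀ N : Yosida A, ζHom A 0 N = 0 := fun N => map_zero N.toHom
  -- The default value `1` on the empty set matters here: the element `0` has infimum `0` over the
  -- nonempty `F`.
  by_cases hF' : F' = ⊥
  · have h1 : infFun (ζHom A 0) F = infFun (ζHom A 0) F' := h 0
    rw [hF', infFun_bot, infFun_comp (f := ζHom A 0) (φ := fun _ => 0) monotone_const hz hF] at h1
    exact zero_ne_one h1
  · obtain ⟨I, hI⟩ := Yosida.isClosed_iff.1 F'.isCompact.isClosed
    rw [← hI] at hM'
    obtain ⟨c, hcI, hcM⟩ := Set.not_subset.1 hM'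
    have h1 : infFun (ζHom A (-|c|)) F = infFun (ζHom A (-|c|)) F' := h (-|c|)
    have hv : ∀ N : Yosida A, ζHom A (-|c|) N = -|N.value c| := fun N => by
      refine (map_neg N.toHom _).trans ?_
      rw [Hom.map_abs]
      rfl
    have h2 : infFun (ζHom A (-|c|)) F ≤ -|M.value c| :=
      hv M ▸ (isLeast_infFun (ζHom A (-|c|)) hF).2 ⟨M, hM, rfl⟩
    obtain ⟨⟨N, hN, hNe⟩, -⟩ := isLeast_infFun (ζHom A (-|c|)) hF'
    rw [← hI] at hN
    rw [hv, N.mem_iff.1 (hN hcI), abs_zero, neg_zero] at hNe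
    rw [h1, ← hNe] at h2
    exact hcM (M.mem_iff.2 (abs_eq_zero.1 (le_antisymm (by linarith) (abs_nonneg _))))

end Functional

/-! ### The points of the Yosida space of `H(A)` -/

/-- The morphism `η_A` with values in the algebra of continuous functions. -/
noncomputable def ηHom (A : BAL.{u}) : Hom (HObj A) C(Compacts (Yosida A), ℝ) := η A

/-- The point of the Yosida space of `H(A)` given by a closed set of maximal `ℓ`-ideals of `A`. -/
noncomputable def ηPoint (A : BAL.{u}) (F : Compacts (Yosida A)) : Yosida (HObj A) :=
  Yosida.comap (ηHom A) (evalPoint F)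

theorem value_ηPoint {A : BAL.{u}} (F : Compacts (Yosida A)) (a : A) :
    (ηPoint A F).value (box a) = g A a F :=
  (Yosida.value_comap (ηHom A) (evalPoint F) (box a)).trans
    (Yosida.value_ofHom (evalAt F) (g A a))

theorem ηPoint_injective (A : BAL.{u}) : Function.Injective (ηPoint A) := by
  intro F F' h
  have key : ∀ a : A, g A a F = g A a F' := fun a => by
    rw [← value_ηPoint, ← value_ηPoint, h]
  exact SetLike.coe_injective
    (Set.Subset.antisymm (subset_of_g_eq key) (subset_of_g_eq fun a => (key a).symm))

/-- The elements `□_a` satisfy the relations in `H(A)`, and taking values at `M` is a morphism to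
`ℝ`. -/
theorem isBox_value_box {A : BAL.{u}} (M : Yosida (HObj A)) :
    IsBox fun a : A => M.value (box a) where
  inf a b := by rw [(isBox_box A).inf]; exact map_inf M.toHom _ _
  const r := by
    rw [(isBox_box A).const]
    refine (map_add M.toHom _ _).trans ?_
    rw [map_mul, map_sub, map_one, Hom.map_algebraMap]
    rfl
  pos a := by
    rw [(isBox_box A).pos]
    refine (map_sup M.toHom _ _).trans ?_
    rw [map_zero]
    rfl
  add a r := by
    rw [(isBox_box A).add]
    refine (map_sub M.toHom _ _).trans ?_
    rw [map_add]
    rfl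
  smul r hr a := by rw [(isBox_box A).smul r hr]; exact map_mul M.toHom _ _

theorem exists_infFun_eq_value_box {A : BAL.{u}} (M : Yosida (HObj A)) :
    ∃ F : Compacts (Yosida A), ∀ a : A, infFun (ζHom A a) F = M.value (box a) := by
  have hq := isBox_value_box M
  rcases hq.map_zero_eq with h0 | h0
  · obtain ⟨F, -, hF⟩ := hq.exists_compacts h0
    exact ⟨F, hF⟩
  · exact ⟨⊥, fun a => (infFun_bot _).trans (hq.eq_one h0 a).symm⟩

/-- Counterpart of `H_hom_ext` for the target `ℝ`, which lives in the lowest universe and so need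
not be the carrier of an object of `BAL.{u}`. -/
theorem hom_real_ext {A : BAL.{u}} {f f' : Hom (HObj A) ℝ} (h : ∀ a : A, f (box a) = f' (box a)) :
    f = f' := by
  have key : f.comp (boxProj A) = f'.comp (boxProj A) := Free.hom_ext h
  refine Hom.ext' fun x => ?_
  obtain ⟨a, rfl⟩ := (boxIdeal A).cls_surjective x
  exact congrArg (fun k : Hom (Free A weight) ℝ => k a) key

theorem ηPoint_surjective (A : BAL.{u}) : Function.Surjective (ηPoint A) := by
  intro M
  obtain ⟨F, hF⟩ := exists_infFun_eq_value_box M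
  refine ⟨F, Yosida.ext' fun x => ?_⟩
  have h : (ηPoint A F).toHom = M.toHom :=
    hom_real_ext fun a => (value_ηPoint F a).trans (hF a)
  rw [Yosida.mem_iff, Yosida.mem_iff, ← Yosida.toHom_apply, ← Yosida.toHom_apply, h]

theorem isIso_Y_map_η (A : BAL.{u}) : IsIso (Y.map (η A).op) := by
  have := isIso_ε (V.obj (Y.obj (op A)))
  -- On points this composite is `ηPoint`; cancelling the invertible `ε` leaves `Y(η_A)`.
  have h : IsIso (ε (V.obj (Y.obj (op A))) ≫ Y.map (η A).op) :=
    CompHausLike.isIso_of_bijective _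
      (show Function.Bijective (ηPoint A) from ⟨ηPoint_injective A, ηPoint_surjective A⟩)
  exact IsIso.of_isIso_comp_left (ε (V.obj (Y.obj (op A)))) _

/-! ### The lifted adjunction -/

/-- First triangle identity of Gelfand duality: `ζ_A(a)` vanishes at `M` exactly when `a ∈ M`. -/
theorem ε_comp_Y_map_ζ (A : BAL.{u}) : ε (Y.obj (op A)) ≫ Y.map (ζ A).op = 𝟙 _ :=
  ConcreteCategory.hom_ext _ _ fun (M : Yosida A) =>
    show Yosida.comap (ζHom A) (evalPoint M) = M from Yosida.ext' fun _ => M.mem_iff.symm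

theorem value_evalPoint {X : Type*} [TopologicalSpace X] [CompactSpace X] (x : X) (f : C(X, ℝ)) :
    (evalPoint x).value f = f x :=
  Yosida.value_ofHom _ _

/-- Second triangle identity of Gelfand duality: the value of `f` at the ideal of `x` is `f x`. -/
theorem ζ_comp_C_map_ε (X : CompHaus.{u}) : ζ (C.obj (op X)) ≫ C.map (ε X).op = 𝟙 _ :=
  Hom.ext' (A := C(X, ℝ)) fun f => ContinuousMap.ext fun x => value_evalPoint x f

/-- Characterises the structure map without inverses, which is the form in which `C` can be applied
to it. -/
theorem FStr_comp (hε : ∀ X : CompHaus.{u}, IsIso (ε X))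
    (hη : ∀ A : BAL.{u}, IsIso (Y.map (η A).op)) {A : BAL.{u}} (α : H.obj A ⟶ A) :
    FStr hε hη α ≫ ε (V.obj (Y.obj (op A))) ≫ Y.map (η A).op = Y.map α.op := by
  have := hε
  have := hη
  simp [FStr]

/-- `ζ_A` is a morphism of algebras for `H`. -/
theorem H_map_ζ_comp_GStr (hε : ∀ X : CompHaus.{u}, IsIso (ε X))
    (hη : ∀ A : BAL.{u}, IsIso (Y.map (η A).op)) {A : BAL.{u}} (α : H.obj A ⟶ A) :
    H.map (ζ A) ≫ GStr (FStr hε hη α) = α ≫ ζ A := by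
  -- The first triangle identity, transported along `V` and `C`.
  have h1 : C.map (V.map (Y.map (ζ A).op)).op ≫ C.map (V.map (ε (Y.obj (op A)))).op = 𝟙 _ := by
    rw [← Functor.map_comp, ← op_comp, ← Functor.map_comp, ε_comp_Y_map_ζ, CategoryTheory.Functor.map_id, op_id,
      CategoryTheory.Functor.map_id]
  have h2 : α ≫ ζ A = ζ (H.obj A) ≫ C.map (Y.map α.op).op := ζ_naturality α
  -- `η_A` is recovered from `Y(η_A)`: naturality of `ζ` at `η_A`, then the second triangle identity
  -- at `V(Y_A)`. This lets both sides be compared through `ζ` at `H(A)`.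
  have h3 : η A = ζ (H.obj A) ≫ C.map (Y.map (η A).op).op ≫
      C.map (ε (V.obj (Y.obj (op A)))).op := by
    rw [← Category.assoc, ← ζ_naturality, Category.assoc, ζ_comp_C_map_ε, Category.comp_id]
  unfold GStr
  rw [← Category.assoc, η_naturality, Category.assoc, reassoc_of% h1, h2, ← FStr_comp hε hη α]
  -- Only the `η_A` on the left is expanded; the one inside `Y(η_A)` on the right must stay.
  nth_rewrite 1 [h3]
  simp only [op_comp, Functor.map_comp, Category.assoc]

/-- `ε_X` is a morphism of coalgebras for `V`. -/
theorem comp_V_map_ε (hε : ∀ X : CompHaus.{u}, IsIso (ε X))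
    (hη : ∀ A : BAL.{u}, IsIso (Y.map (η A).op)) {X : CompHaus.{u}} (σ : X ⟶ V.obj X) :
    σ ≫ V.map (ε X) = ε X ≫ FStr hε hη (GStr σ) := by
  have := hε
  have := hη
  have h1 := ε_naturality (σ ≫ V.map (ε X))
  -- Naturality of `ε` at `σ ≫ V(ε_X)` moves the image of `G_σ` under `Y` past `ε`; the factors left
  -- on the right are those that `FStr` inverts.
  have h2 : ε X ≫ Y.map (GStr σ).op = (σ ≫ V.map (ε X)) ≫ ε _ ≫ Y.map (η (C.obj (op X))).op := by
    rw [← Category.assoc, h1]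
    simp only [GStr, op_comp, Functor.map_comp, Category.assoc]
  rw [FStr, reassoc_of% h2]
  simp

/-- The dual adjunction between algebras and coalgebras with units `ζ` and `ε`. -/
noncomputable def adjunction (hε : ∀ X : CompHaus.{u}, IsIso (ε X))
    (hη : ∀ A : BAL.{u}, IsIso (Y.map (η A).op)) : (F hε hη).rightOp ⊣ G where
  unit :=
    { app A := { f := ζ A.a, h := H_map_ζ_comp_GStr hε hη A.str }
      naturality _ _ γ := Endofunctor.Algebra.Hom.ext (ζ_naturality γ.f) }
  counit :=
    { app X := Quiver.Hom.op
        { f := ε X.unop.V, h := comp_V_map_ε hε hη X.unop.str }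
      naturality _ _ φ := Quiver.Hom.unop_inj
        (Endofunctor.Coalgebra.Hom.ext (ε_naturality φ.unop.f).symm) }
  -- Morphisms of algebras and coalgebras are determined by their underlying maps, so the triangle
  -- identities are those of Gelfand duality.
  left_triangle_components A := Quiver.Hom.unop_inj
    (Endofunctor.Coalgebra.Hom.ext (ε_comp_Y_map_ζ A.a))
  right_triangle_components X := Endofunctor.Algebra.Hom.ext (ζ_comp_C_map_ε X.unop.V)

end Bal

/-- The two isomorphism statements come first because `F` takes them as arguments. Contravariance is
expressed by `rightOp`: the counit lives in the opposite of the category of coalgebras, and its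
components there are the maps `ε`. -/
theorem mainTheorem2 :
    ∃ (hε : ∀ X : CompHaus.{u}, IsIso (Bal.ε X))
      (hη : ∀ A : Bal.BAL.{u}, IsIso (Bal.Y.map (Bal.η A).op))
      (adj : (Bal.F hε hη).rightOp ⊣ Bal.G),
      (∀ A : Endofunctor.Algebra Bal.H.{u}, (adj.unit.app A).f = Bal.ζ A.a) ∧
      (∀ X : Endofunctor.Coalgebra Bal.V.{u}, (adj.counit.app (op X)).unop.f = Bal.ε X.V) := by
  exact ⟨Bal.isIso_ε, Bal.isIso_Y_map_η, Bal.adjunction Bal.isIso_ε Bal.isIso_Y_map_η,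
    fun _ => rfl, fun _ => rfl⟩
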